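/- All matrix norms are $\ell^2$ operator norms, vector norms are Euclidean, and $\rho(X)$ is the spectral radius. Call $\zeta$ a Gelfand constant of a square matrix $X$ at level $\epsilon>0$, written $\zeta=\zeta_\epsilon(X)$, if $\|X^t\|\le\zeta(\rho(X)+\epsilon)^t$ for all integers $t\ge 0$. **Setting.** Let $1\le k<n$ and let $A\in\mathbb R^{n\times n}$ have eigenvalues (necessarily real) with $|\lambda_1|>\dots>|\lambda_k|>1>|\lambda_{k+1}|>\dots>|\lambda_n|$. Let $E_u$ be the span of the eigenvectors of $\lambda_1,\dots,\lambda_k$, let $P_1\in\mathbb R^{n\times k}$ and $P_2\in\mathbb R^{n\times(n-k)}$ have orthonormal columns spanning $E_u$ and $E_u^\perp$, and put $M_1=P_1^*AP_1$, $M_2=P_2^*AP_2$, $\mathrm{gap}=\bigl|\prod_{i\ne j,\ i,j\le k}(\lambda_i^{-1}-\lambda_j^{-1})\bigr|$. Write $M_1=\bar P^{-1}\mathrm{diag}(\lambda_1,\dots,\lambda_k)\bar P$, where the rows $\bar P_1^*,\dots,\bar P_k^*$ of $\bar P$ have unit length. Consider the open-loop system $x_0=0$, $x_{t+1}=Ax_t+\eta_t$,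 with random $\eta_t\in\mathbb R^n$, $\mathbb E\,\eta_t=0$, $\|\eta_t\|<C$ almost surely, and let $z_t=M_1^{-t}P_1^*x_t$. Assume that for all $i\le k$ and $t\ge1$ the random variable $|\bar P_i^*z_t|$ has a probability density whose essential supremum is smaller than $C_z$. **Estimators.** Given $T$, let $D=[x_1,\dots,x_T]=U\Sigma V^*$ be a singular value decomposition with nonincreasing singular values, let $\hat P_1$ consist of the first $k$ columns of $U$, and let $\hat M_1$ be a minimizer of $\sum_{t=0}^{T}\|\hat P_1^*x_{t+1}-M\hat P_1^*x_t\|^2$ over $M\in\mathbb R^{k\times k}$. **Claim.** Let $\theta,\epsilon_1,\epsilon_2>0$ with $|\lambda_{k+1}|+\epsilon_2<1$, and let $\zeta_{\epsilon_1}(A)$, $\zeta_{\epsilon_2}(M_2)$ be Gelfand constants. There is a constant $c>0$, depending only on $C,C_z,|\lambda_1|,|\lambda_k|,|\lambda_{k+1}|,\theta,\epsilon_1,\epsilon_2$ and the values $\zeta_{\epsilon_1}(A),\zeta_{\epsilon_2}(M_2)$ (so not on $n$, $k$, the system, $\delta$ or $\tau$ otherwise), such that for every $\delta\in(0,1]$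 and every integer $$T\ \ge\ c\Bigl(1+k\log k+\log(n-k)+\log\tfrac1\delta-\log\mathrm{gap}\Bigr),$$ with probability at least $1-4\theta$ the following holds for every choice of the singular value decomposition. The minimizer $\hat M_1$ exists and is unique. There is an orthonormal basis $P_1$ of $E_u$ with $\|P_1-\hat P_1\|<\delta$. For every such $P_1$, with $M_1=P_1^*AP_1$, and every integer $\tau\ge1$, $$\|\hat M_1^{\tau}-M_1^{\tau}\|\ \le\ 3\,\tau\,\|A\|\,\zeta_{\epsilon_1}(A)^2\,(|\lambda_1|+\epsilon_1)^{\tau-1}\,\delta .$$ -/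

import Mathlib

open MeasureTheory ProbabilityTheory
open scoped Matrix Matrix.Norms.L2Operator

noncomputable section

namespace LTI

/-! All matrix norms below are the `ℓ²` operator norm, all vector norms are Euclidean. -/

/-- Spectral radius of a real square matrix: the largest modulus of a complex eigenvalue. -/
def specRad {m : ℕ} (X : Matrix (Fin m) (Fin m) ℝ) : ℝ :=
  (spectralRadius ℂ (X.map (algebraMap ℝ ℂ))).toReal

/-- `ζ` is a Gelfand constant of `X` at level `ε`: `‖X ^ t‖ ≤ ζ (ρ(X) + ε) ^ t` for all `t`. -/
def IsGelfandConst {m : ℕ} (X : Matrix (Fin m) (Fin m) ℝ) (ε ζ : ℝ) : Prop :=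
  ∀ t : ℕ, ‖X ^ t‖ ≤ ζ * (specRad X + ε) ^ t

/-- The eigenvalues of `A` (with multiplicity) are `lam 0, lam 1, …`, with
`|lam 0| > … > |lam (k-1)| > 1 > |lam k| > … > |lam (n-1)|`.
Complex eigenvalues of a real matrix come in conjugate pairs of equal modulus, so
eigenvalues of pairwise distinct moduli are real. -/
structure SpectralAssumption {n : ℕ} (A : Matrix (Fin n) (Fin n) ℝ) (lam : Fin n → ℝ)
    (k : ℕ) : Prop where
  charpoly_eq : A.charpoly = ∏ i, (Polynomial.X - Polynomial.C (lam i))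
  strictAnti : StrictAnti fun i => |lam i|
  unstable : ∀ i : Fin n, (i : ℕ) < k → 1 < |lam i|
  stable : ∀ i : Fin n, k ≤ (i : ℕ) → |lam i| < 1

/-- `gap = |∏_{i ≠ j} (1/λ_i - 1/λ_j)|`, over ordered pairs of unstable indices. -/
def gap {n : ℕ} (lam : Fin n → ℝ) (k : ℕ) : ℝ :=
  |∏ i : Fin n, ∏ j : Fin n,
    if (i : ℕ) < k ∧ (j : ℕ) < k ∧ i ≠ j then (lam i)⁻¹ - (lam j)⁻¹ else 1|

/-- The unstable subspace: the span of the eigenvectors of the first `k` eigenvalues. -/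
def unstableSubspace {n : ℕ} (A : Matrix (Fin n) (Fin n) ℝ) (lam : Fin n → ℝ) (k : ℕ) :
    Submodule ℝ (Fin n → ℝ) :=
  ⨆ (i : Fin n) (_ : (i : ℕ) < k), Module.End.eigenspace (Matrix.toLin' A) (lam i)

/-- The columns of `P` form an orthonormal basis of the subspace `E` of `ℝⁿ`. -/
def IsOrthonormalBasisOf {n k : ℕ} (P : Matrix (Fin n) (Fin k) ℝ)
    (E : Submodule ℝ (Fin n → ℝ)) : Prop :=
  Pᵀ * P = 1 ∧ Submodule.span ℝ (Set.range Pᵀ) = E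

/-- The block `Pᵀ A P`. With `P = P₁` this is `M₁`, with `P = P₂` it is `M₂`. -/
def block {n k : ℕ} (A : Matrix (Fin n) (Fin n) ℝ) (P : Matrix (Fin n) (Fin k) ℝ) :
    Matrix (Fin k) (Fin k) ℝ :=
  Pᵀ * A * P

/-- `M = P̄⁻¹ J P̄` is a Jordan (here: diagonal) form of `M` with eigenvalues `lam`, where the rows
of `P̄`, which are left eigenvectors of `M`, are normalized to unit length. -/
structure IsJordanForm {k : ℕ} (M : Matrix (Fin k) (Fin k) ℝ) (lam : Fin k → ℝ)
    (Pbar : Matrix (Fin k) (Fin k) ℝ) : Prop where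
  isUnit : IsUnit Pbar.det
  eq : M = Pbar⁻¹ * Matrix.diagonal lam * Pbar
  unit_row : ∀ i, ∑ j, Pbar i j ^ 2 = 1

/-- The open-loop trajectory `x_0 = 0`, `x_{t+1} = A x_t + η_t`. -/
def state {n : ℕ} (A : Matrix (Fin n) (Fin n) ℝ) (η : ℕ → EuclideanSpace ℝ (Fin n)) :
    ℕ → EuclideanSpace ℝ (Fin n)
  | 0 => 0
  | t + 1 => Matrix.toEuclideanLin A (state A η t) + η t

/-- The noise is measurable, bounded by `C`, and has mean zero. -/
structure NoiseAssumption {Ω : Type*} [MeasurableSpace Ω] (μ : Measure Ω) {n : ℕ}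
    (η : ℕ → Ω → EuclideanSpace ℝ (Fin n)) (C : ℝ) : Prop where
  measurable : ∀ t, Measurable (η t)
  bounded : ∀ t, ∀ᵐ ω ∂μ, ‖η t ω‖ < C
  mean_zero : ∀ t, ∫ ω, η t ω ∂μ = 0

/-- The rescaled unstable coordinates `z_t = M₁^{-t} P₁ᵀ x_t` of the open-loop trajectory. -/
def zCoord {n k : ℕ} (A : Matrix (Fin n) (Fin n) ℝ) (P₁ : Matrix (Fin n) (Fin k) ℝ)
    (η : ℕ → EuclideanSpace ℝ (Fin n)) (t : ℕ) : Fin k → ℝ :=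
  ((block A P₁)⁻¹ ^ t * P₁ᵀ) *ᵥ (state A η t).ofLp

/-- For all `t ≥ 1` and all `i`, the random variable `|P̄_i z_t|` has a probability density
function whose essential supremum is smaller than `Cz`. -/
def PdfAssumption {Ω : Type*} [MeasurableSpace Ω] (μ : Measure Ω) {n k : ℕ}
    (A : Matrix (Fin n) (Fin n) ℝ) (P₁ : Matrix (Fin n) (Fin k) ℝ)
    (Pbar : Matrix (Fin k) (Fin k) ℝ) (η : ℕ → Ω → EuclideanSpace ℝ (Fin n)) (Cz : ℝ) : Prop :=
  ∀ t : ℕ, 1 ≤ t → ∀ i : Fin k,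
    HasPDF (fun ω => |(Pbar *ᵥ zCoord A P₁ (fun s => η s ω) t) i|) μ volume ∧
    essSup (pdf (fun ω => |(Pbar *ᵥ zCoord A P₁ (fun s => η s ω) t) i|) μ volume) volume
      < ENNReal.ofReal Cz

/-- The data matrix `D = [x_1, …, x_T]`. -/
def dataMatrix {n : ℕ} (x : ℕ → EuclideanSpace ℝ (Fin n)) (T : ℕ) :
    Matrix (Fin n) (Fin T) ℝ :=
  Matrix.of fun i t => x (t + 1) i

/-- `D = U Σ Vᵀ` is a singular value decomposition, with singular values
`σ 0 ≥ σ 1 ≥ … ≥ 0` on the diagonal of the `n × T` matrix `Σ`. -/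
structure IsSVD {n T : ℕ} (D : Matrix (Fin n) (Fin T) ℝ) (U : Matrix (Fin n) (Fin n) ℝ)
    (σ : ℕ → ℝ) (V : Matrix (Fin T) (Fin T) ℝ) : Prop where
  left : Uᵀ * U = 1
  right : Vᵀ * V = 1
  antitone : Antitone σ
  nonneg : ∀ i, 0 ≤ σ i
  eq : D = U * (Matrix.of fun (i : Fin n) (j : Fin T) => if (i : ℕ) = j then σ i else 0) * Vᵀ

/-- The first `k` columns of `U`. -/
def topColumns {n k : ℕ} (h : k ≤ n) (U : Matrix (Fin n) (Fin n) ℝ) :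
    Matrix (Fin n) (Fin k) ℝ :=
  U.submatrix id (Fin.castLE h)

/-- The square loss `∑_{t=0}^T ‖P̂ᵀ x_{t+1} - M P̂ᵀ x_t‖²`. -/
def loss {n k : ℕ} (x : ℕ → EuclideanSpace ℝ (Fin n)) (T : ℕ) (Phat : Matrix (Fin n) (Fin k) ℝ)
    (M : Matrix (Fin k) (Fin k) ℝ) : ℝ :=
  ∑ t ∈ Finset.range (T + 1),
    ‖Matrix.toEuclideanLin Phatᵀ (x (t + 1)) -
      Matrix.toEuclideanLin M (Matrix.toEuclideanLin Phatᵀ (x t))‖ ^ 2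

/-- `M` minimizes the square loss over all `k × k` matrices. -/
def IsLeastSquares {n k : ℕ} (x : ℕ → EuclideanSpace ℝ (Fin n)) (T : ℕ)
    (Phat : Matrix (Fin n) (Fin k) ℝ) (M : Matrix (Fin k) (Fin k) ℝ) : Prop :=
  ∀ M' : Matrix (Fin k) (Fin k) ℝ, loss x T Phat M ≤ loss x T Phat M'

end LTI

end

/-!
Write `P₁`, `P₂` for orthonormal bases of `E_u` and `E_u^⊥`, and `D` for the data matrix. Since
`E_u` is invariant, the stable coordinates `P₂ᵀ x_t` satisfy a recursion of their own, driven by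
`M₂ = P₂ᵀ A P₂`, and stay bounded (`euclNorm_stable_le`). In the left eigenbasis of `M₁` the
unstable coordinates `v_t = P̄ P₁ᵀ x_t` follow scalar recursions `v_{t+1,i} = λ_i v_{t,i} + O(1)`,
so `v_{T-j,i} = λ_i^{-j} v_{T,i} + O(1)`: up to bounded errors the last `k` columns of `P̄ P₁ᵀ D`
form the Vandermonde matrix of the `λ_i⁻¹` with rows scaled by `v_{T,i}`. The squared determinant
of that Vandermonde matrix is the gap (`gap_eq_det_sq`), so Cramer's rule bounds its inverse. The
density assumption gives `|v_{T,i}| ≥ |λ_k|^T θ / (k Cz)` for all `i` outside an event of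
probability at most `2 θ` (`exists_good_event`). Hence `Dᵀ` expands the norms of vectors in `E_u`
by a factor `L` of order `|λ_k|^T`, up to factors that depend on `k` and the gap but not on `T`
(`euclNorm_dataMatrix_ge`).

By the max-min principle the first `k` singular values of `D` are at least `L`. The frame `Ph` of
leading left singular vectors is then `D R` with `‖R‖ ≤ 1 / L`, so its component `P₂ᵀ D R` outside
`E_u` has norm `O(T/L)`, and a polar decomposition turns this into an orthonormal basis `Qs` of
`E_u` at distance `O(T/L)` from `Ph`. The same `R` solves the normal equations: the unique least
squares solution is `Phᵀ A Ph + Phᵀ N R`, where `N` is the noise matrix, and it is within `O(T/L)`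
of `M⋆ = Qsᵀ A Qs`.

The bound on powers has to hold for all `τ` at once, with the rate `|λ₁| + ε₁` of the Gelfand
constant of `A` itself, so perturbing that Gelfand bound would be too lossy. Instead,
interpolation on the spectrum, with the same Vandermonde matrix, gives `‖M⋆ᵗ‖ ≤ K |λ₁|ᵗ` with an
explicit `K` (`norm_pow_le_of_isJordanForm`). As `K` is much smaller than `L / T`, the powers of
the estimate are at most `K (|λ₁| + ε₁)ᵗ`, and in a telescoping sum the factor `K` is absorbed by
the exponentially small difference of the estimate and `M⋆`. The distance of `M⋆` from the block
of any other basis within `δ` of `Ph` is a second telescoping sum, with the Gelfand constant of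
`A` on both sides (`estimator_accuracy`).

Finally `T` must make `|λ_k|^T` beat `T`, `1 / δ`, and quantities of size `exp (O(k log k)) / gap`
and `exp (O(k))`. Hadamard's inequality gives `gap ≤ k^k |λ_k|^{-k(k-1)}`, so `k log k - log gap`
is nonnegative and controls `k log k` and `-log gap` separately (`exists_sampleSize_const`).
-/

namespace LTI

/-! ### Euclidean norms and operator norms -/

/-- The Euclidean norm of a vector given as a plain function. -/
noncomputable def euclNorm {ι : Type*} [Fintype ι] (x : ι → ℝ) : ℝ := ‖WithLp.toLp 2 x‖

lemma euclNorm_sq {ι : Type*} [Fintype ι] (x : ι → ℝ) : euclNorm x ^ 2 = ∑ i, x i ^ 2 := by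
  simp [euclNorm, EuclideanSpace.norm_sq_eq]

lemma euclNorm_nonneg {ι : Type*} [Fintype ι] (x : ι → ℝ) : 0 ≤ euclNorm x := norm_nonneg _

lemma euclNorm_add_le {ι : Type*} [Fintype ι] (x y : ι → ℝ) :
    euclNorm (x + y) ≤ euclNorm x + euclNorm y :=
  norm_add_le _ _

lemma euclNorm_sub_le_add {ι : Type*} [Fintype ι] (x y : ι → ℝ) :
    euclNorm x - euclNorm y ≤ euclNorm (x + y) := by
  have := norm_sub_norm_le (WithLp.toLp 2 x) (-(WithLp.toLp 2 y))
  rw [norm_neg, sub_neg_eq_add] at this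
  exact this

lemma euclNorm_pos {ι : Type*} [Fintype ι] {x : ι → ℝ} (hx : x ≠ 0) : 0 < euclNorm x := by
  rw [euclNorm, norm_pos_iff]
  simpa using hx

lemma euclNorm_mulVec_le {ι κ : Type*} [Fintype ι] [Fintype κ] [DecidableEq κ]
    (A : Matrix ι κ ℝ) (x : κ → ℝ) : euclNorm (A *ᵥ x) ≤ ‖A‖ * euclNorm x :=
  Matrix.l2_opNorm_mulVec A (WithLp.toLp 2 x)

lemma opNorm_le_of_euclNorm_le {ι κ : Type*} [Fintype ι] [Fintype κ] [DecidableEq κ]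
    (A : Matrix ι κ ℝ) {c : ℝ} (hc : 0 ≤ c) (h : ∀ x, euclNorm (A *ᵥ x) ≤ c * euclNorm x) :
    ‖A‖ ≤ c := by
  rw [Matrix.l2_opNorm_def]
  refine ContinuousLinearMap.opNorm_le_bound _ hc fun x => ?_
  exact h x.ofLp

/-- The operator norm is at most the Frobenius norm. -/
lemma opNorm_sq_le_sum {ι κ : Type*} [Fintype ι] [Fintype κ] [DecidableEq κ]
    (A : Matrix ι κ ℝ) : ‖A‖ ^ 2 ≤ ∑ i, ∑ j, A i j ^ 2 := by
  have h0 : 0 ≤ ∑ i, ∑ j, A i j ^ 2 :=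
    Finset.sum_nonneg fun i _ => Finset.sum_nonneg fun j _ => sq_nonneg _
  rw [← Real.sq_sqrt h0]
  refine pow_le_pow_left₀ (norm_nonneg _) (opNorm_le_of_euclNorm_le A (Real.sqrt_nonneg _) ?_) 2
  intro x
  refine le_of_sq_le_sq ?_ (mul_nonneg (Real.sqrt_nonneg _) (euclNorm_nonneg _))
  rw [mul_pow, Real.sq_sqrt h0, euclNorm_sq, euclNorm_sq, Finset.sum_mul]
  exact Finset.sum_le_sum fun i _ => Finset.sum_mul_sq_le_sq_mul_sq Finset.univ (A i) x

lemma opNorm_le_of_abs_entry_le {k : ℕ} (A : Matrix (Fin k) (Fin k) ℝ) {b : ℝ} (hb : 0 ≤ b)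
    (h : ∀ i j, |A i j| ≤ b) : ‖A‖ ≤ k * b := by
  refine le_of_sq_le_sq ((opNorm_sq_le_sum A).trans ?_) (by positivity)
  calc ∑ i, ∑ j, A i j ^ 2 ≤ ∑ _i : Fin k, ∑ _j : Fin k, b ^ 2 := by
        refine Finset.sum_le_sum fun i _ => Finset.sum_le_sum fun j _ => ?_
        exact sq_le_sq' (abs_le.1 (h i j)).1 (abs_le.1 (h i j)).2
    _ = (k * b) ^ 2 := by simp; ring

lemma opNorm_transpose {ι κ : Type*} [Fintype ι] [Fintype κ] [DecidableEq κ] [DecidableEq ι]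
    (A : Matrix ι κ ℝ) : ‖Aᵀ‖ = ‖A‖ := by
  rw [← Matrix.conjTranspose_eq_transpose_of_trivial, Matrix.l2_opNorm_conjTranspose]

lemma opNorm_one_le {κ : Type*} [Fintype κ] [DecidableEq κ] : ‖(1 : Matrix κ κ ℝ)‖ ≤ 1 :=
  opNorm_le_of_euclNorm_le _ zero_le_one (by simp)

lemma opNorm_isometry_le {ι κ : Type*} [Fintype ι] [Fintype κ] [DecidableEq κ]
    {P : Matrix ι κ ℝ} (h : Pᵀ * P = 1) : ‖P‖ ≤ 1 := by
  have h1 := Matrix.l2_opNorm_conjTranspose_mul_self P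
  rw [Matrix.conjTranspose_eq_transpose_of_trivial, h] at h1
  have h2 := opNorm_one_le (κ := κ)
  nlinarith [norm_nonneg P]

lemma euclNorm_sq_eq_dotProduct {ι : Type*} [Fintype ι] (x : ι → ℝ) : euclNorm x ^ 2 = x ⬝ᵥ x := by
  rw [euclNorm_sq, dotProduct]
  simp [sq]

lemma euclNorm_isometry_mulVec {ι κ : Type*} [Fintype ι] [Fintype κ] [DecidableEq κ]
    {P : Matrix ι κ ℝ} (h : Pᵀ * P = 1) (x : κ → ℝ) : euclNorm (P *ᵥ x) = euclNorm x := by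
  refine (sq_eq_sq₀ (euclNorm_nonneg _) (euclNorm_nonneg _)).1 ?_
  rw [euclNorm_sq_eq_dotProduct, euclNorm_sq_eq_dotProduct, Matrix.dotProduct_mulVec,
    Matrix.vecMul_mulVec, h, Matrix.vecMul_one]

lemma euclNorm_ge_of_inverse {ι κ : Type*} [Fintype ι] [Fintype κ] [DecidableEq κ] [DecidableEq ι]
    {V : Matrix ι κ ℝ} {W : Matrix κ ι ℝ} (h : W * V = 1) {c : ℝ} (hc : ‖W‖ ≤ c) (x : κ → ℝ) :
    euclNorm x ≤ c * euclNorm (V *ᵥ x) := by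
  calc euclNorm x = euclNorm (W *ᵥ (V *ᵥ x)) := by
        rw [Matrix.mulVec_mulVec, h, Matrix.one_mulVec]
    _ ≤ ‖W‖ * euclNorm (V *ᵥ x) := euclNorm_mulVec_le _ _
    _ ≤ _ := by gcongr; exact euclNorm_nonneg _

/-! ### Powers of nearby matrices -/

/-- Telescoping of a difference of powers of two elements that need not commute. -/
lemma pow_sub_pow_eq_sum {R : Type*} [Ring R] (X Y : R) (t : ℕ) :
    X ^ t - Y ^ t = ∑ i ∈ Finset.range t, Y ^ (t - 1 - i) * (X - Y) * X ^ i := by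
  induction t with
  | zero => simp
  | succ t ih =>
    rw [Finset.sum_range_succ]
    have h : ∑ i ∈ Finset.range t, Y ^ (t + 1 - 1 - i) * (X - Y) * X ^ i
        = Y * ∑ i ∈ Finset.range t, Y ^ (t - 1 - i) * (X - Y) * X ^ i := by
      rw [Finset.mul_sum]
      refine Finset.sum_congr rfl fun i hi => ?_
      have : t + 1 - 1 - i = (t - 1 - i) + 1 := by
        have := Finset.mem_range.1 hi
        omega
      rw [this, pow_succ', mul_assoc, mul_assoc, mul_assoc]
    rw [h, ← ih]
    simp [pow_succ']
    noncomm_ring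

lemma norm_pow_sub_pow_le {R : Type*} [NormedRing R] {X Y : R} {α β r : ℝ}
    (hX : ∀ t : ℕ, ‖X ^ t‖ ≤ α * r ^ t) (hY : ∀ t : ℕ, ‖Y ^ t‖ ≤ β * r ^ t) (t : ℕ) :
    ‖X ^ t - Y ^ t‖ ≤ t * (α * β) * r ^ (t - 1) * ‖X - Y‖ := by
  rw [pow_sub_pow_eq_sum]
  calc ‖∑ i ∈ Finset.range t, Y ^ (t - 1 - i) * (X - Y) * X ^ i‖
      ≤ ∑ i ∈ Finset.range t, ‖Y ^ (t - 1 - i) * (X - Y) * X ^ i‖ := norm_sum_le _ _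
    _ ≤ ∑ i ∈ Finset.range t, (α * β) * r ^ (t - 1) * ‖X - Y‖ := by
        refine Finset.sum_le_sum fun i hi => ?_
        have hi := Finset.mem_range.1 hi
        calc ‖Y ^ (t - 1 - i) * (X - Y) * X ^ i‖
            ≤ ‖Y ^ (t - 1 - i)‖ * ‖X - Y‖ * ‖X ^ i‖ := by
              refine (norm_mul_le _ _).trans ?_
              gcongr
              exact norm_mul_le _ _
          _ ≤ (β * r ^ (t - 1 - i)) * ‖X - Y‖ * (α * r ^ i) := by
              have := (norm_nonneg _).trans (hY (t - 1 - i))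
              gcongr
              · exact hY _
              · exact hX _
          _ = (α * β) * (r ^ (t - 1 - i) * r ^ i) * ‖X - Y‖ := by ring
          _ = _ := by rw [← pow_add]; congr 3; omega
    _ = _ := by simp; ring

/-- If the powers of `Y` grow at most like `K aᵗ`, those of a perturbation `X` grow at most like
`K (a + K ‖X - Y‖)ᵗ`. -/
lemma norm_pow_le_of_perturbation {R : Type*} [NormedRing R] {X Y : R} {K a : ℝ}
    (ha : 0 ≤ a) (hK : 0 ≤ K) (hY : ∀ t : ℕ, ‖Y ^ t‖ ≤ K * a ^ t) (t : ℕ) :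
    ‖X ^ t‖ ≤ K * (a + K * ‖X - Y‖) ^ t := by
  induction t using Nat.strong_induction_on with
  | _ t ih =>
    have h1 : X ^ t = Y ^ t + ∑ i ∈ Finset.range t, Y ^ (t - 1 - i) * (X - Y) * X ^ i := by
      rw [← pow_sub_pow_eq_sum]; abel
    set q := K * ‖X - Y‖ with hq
    have h2 : (a + q) ^ t - a ^ t = ∑ i ∈ Finset.range t, a ^ (t - 1 - i) * q * (a + q) ^ i := by
      rw [pow_sub_pow_eq_sum]
      simp
    calc ‖X ^ t‖ ≤ ‖Y ^ t‖ + ∑ i ∈ Finset.range t, ‖Y ^ (t - 1 - i) * (X - Y) * X ^ i‖ := by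
          rw [h1]
          exact (norm_add_le _ _).trans (by gcongr; exact norm_sum_le _ _)
      _ ≤ K * a ^ t + ∑ i ∈ Finset.range t, K * (a ^ (t - 1 - i) * q * (a + q) ^ i) := by
          gcongr with i hi
          · exact hY t
          · have hi := Finset.mem_range.1 hi
            calc ‖Y ^ (t - 1 - i) * (X - Y) * X ^ i‖
                ≤ ‖Y ^ (t - 1 - i)‖ * ‖X - Y‖ * ‖X ^ i‖ := by
                  refine (norm_mul_le _ _).trans ?_
                  gcongr
                  exact norm_mul_le _ _
              _ ≤ (K * a ^ (t - 1 - i)) * ‖X - Y‖ * (K * (a + q) ^ i) := by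
                  gcongr
                  · exact hY _
                  · exact ih i hi
              _ = _ := by rw [hq]; ring
      _ = K * (a + q) ^ t := by rw [← Finset.mul_sum, ← h2]; ring

/-! ### Orthonormal bases near a given frame -/

/-- A positive semidefinite `H` satisfies `‖1 - H‖ ≤ ‖1 - H²‖`, since `1 + H` expands norms. -/
lemma norm_one_sub_le_of_posSemidef {κ : Type*} [Fintype κ] [DecidableEq κ] {H : Matrix κ κ ℝ}
    (hH : H.PosSemidef) : ‖1 - H‖ ≤ ‖1 - H * H‖ := by
  refine opNorm_le_of_euclNorm_le _ (norm_nonneg _) fun x => ?_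
  set y := (1 - H) *ᵥ x with hy
  have h1 : (1 - H * H) *ᵥ x = y + H *ᵥ y := by
    rw [hy, Matrix.mulVec_mulVec, ← Matrix.add_mulVec]
    congr 1
    noncomm_ring
  have h2 : 0 ≤ y ⬝ᵥ H *ᵥ y := by simpa using hH.dotProduct_mulVec_nonneg y
  have h3 : euclNorm y ^ 2 ≤ y ⬝ᵥ ((1 - H * H) *ᵥ x) := by
    rw [h1, dotProduct_add, euclNorm_sq_eq_dotProduct]
    linarith
  have h4 : y ⬝ᵥ ((1 - H * H) *ᵥ x) ≤ euclNorm y * euclNorm ((1 - H * H) *ᵥ x) := by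
    have := real_inner_le_norm (WithLp.toLp 2 ((1 - H * H) *ᵥ x)) (WithLp.toLp 2 y)
    rw [EuclideanSpace.inner_toLp_toLp] at this
    rw [mul_comm]
    simpa [euclNorm] using this
  have h5 := euclNorm_mulVec_le (1 - H * H) x
  have h6 := euclNorm_nonneg y
  rcases h6.eq_or_lt with h | h
  · rw [← h]
    exact mul_nonneg (norm_nonneg _) (euclNorm_nonneg _)
  · have : euclNorm y ≤ euclNorm ((1 - H * H) *ᵥ x) := by
      by_contra hc
      push Not at hc
      nlinarith
    exact this.trans h5

open scoped MatrixOrder in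
/-- If the frame `Ph` has a small component `P₂ᵀ Ph` orthogonal to the range of `P₁`, then rotating
`P₁` by the orthogonal polar factor of `P₁ᵀ Ph` gives an orthonormal basis close to `Ph`. -/
lemma exists_rotation_close {ι κ κ' : Type*} [Fintype ι] [Fintype κ] [Fintype κ'] [DecidableEq ι]
    [DecidableEq κ] [DecidableEq κ'] {P₁ Ph : Matrix ι κ ℝ} {P₂ : Matrix ι κ' ℝ}
    (h₁ : P₁ᵀ * P₁ = 1) (h₂ : P₂ᵀ * P₂ = 1) (h : P₁ * P₁ᵀ + P₂ * P₂ᵀ = 1) (hPh : Phᵀ * Ph = 1)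
    (hs : ‖P₂ᵀ * Ph‖ < 1) :
    ∃ W : Matrix κ κ ℝ, Wᵀ * W = 1 ∧ ‖P₁ * W - Ph‖ ≤ 2 * ‖P₂ᵀ * Ph‖ := by
  set B := P₁ᵀ * Ph with hB
  set S := P₂ᵀ * Ph with hS
  have hG : Bᵀ * B = 1 - Sᵀ * S := by
    have : Phᵀ * (P₁ * P₁ᵀ + P₂ * P₂ᵀ) * Ph = Bᵀ * B + Sᵀ * S := by
      simp only [hB, hS, Matrix.transpose_mul, Matrix.transpose_transpose, Matrix.mul_add,
        Matrix.add_mul, Matrix.mul_assoc]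
    rw [h, Matrix.mul_one, hPh] at this
    rw [this]; abel
  have hGpos : (Bᵀ * B).PosSemidef := by
    have := Matrix.posSemidef_conjTranspose_mul_self B
    rwa [Matrix.conjTranspose_eq_transpose_of_trivial] at this
  have hnorm : ‖1 - Bᵀ * B‖ ≤ ‖S‖ ^ 2 := by
    rw [hG, sub_sub_cancel, sq]
    exact (Matrix.l2_opNorm_mul _ _).trans_eq (by rw [opNorm_transpose])
  obtain ⟨H, hHpos, hHH⟩ : ∃ H : Matrix κ κ ℝ, H.PosSemidef ∧ H * H = Bᵀ * B :=
    ⟨CFC.sqrt (Bᵀ * B), Matrix.nonneg_iff_posSemidef.1 (CFC.sqrt_nonneg (Bᵀ * B)),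
      CFC.sqrt_mul_sqrt_self (Bᵀ * B) hGpos.nonneg⟩
  have hHt : Hᵀ = H := by
    have := hHpos.isHermitian.eq
    rwa [Matrix.conjTranspose_eq_transpose_of_trivial] at this
  have hGu : IsUnit (Bᵀ * B) := by
    have h1 : ‖1 - Bᵀ * B‖ < 1 := hnorm.trans_lt (by nlinarith [norm_nonneg S])
    have := (Units.oneSub (1 - Bᵀ * B) h1).isUnit
    simpa using this
  have hdet : IsUnit H.det := by
    rw [← hHH, Matrix.isUnit_iff_isUnit_det, Matrix.det_mul] at hGu
    exact isUnit_of_mul_isUnit_left hGu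
  have hW : (B * H⁻¹)ᵀ * (B * H⁻¹) = 1 := by
    rw [Matrix.transpose_mul, Matrix.transpose_nonsing_inv, hHt, Matrix.mul_assoc,
      ← Matrix.mul_assoc Bᵀ, ← hHH, Matrix.mul_assoc H, Matrix.mul_nonsing_inv _ hdet,
      Matrix.mul_one, Matrix.nonsing_inv_mul _ hdet]
  refine ⟨B * H⁻¹, hW, ?_⟩
  set W := B * H⁻¹ with hWdef
  have hWH : W * H = B := by rw [hWdef, Matrix.mul_assoc, Matrix.nonsing_inv_mul _ hdet,
    Matrix.mul_one]
  have h4 : P₁ * W - Ph = P₁ * (W * (1 - H)) - P₂ * S := by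
    have : Ph = P₁ * B + P₂ * S := by
      rw [hB, hS, ← Matrix.mul_assoc, ← Matrix.mul_assoc, ← Matrix.add_mul, h, Matrix.one_mul]
    nth_rw 1 [this]
    rw [Matrix.mul_sub, Matrix.mul_one, hWH, Matrix.mul_sub]
    abel
  have h5 : ‖1 - H‖ ≤ ‖S‖ ^ 2 :=
    (norm_one_sub_le_of_posSemidef hHpos).trans (by rw [hHH]; exact hnorm)
  calc ‖P₁ * W - Ph‖ ≤ ‖P₁ * (W * (1 - H))‖ + ‖P₂ * S‖ := by rw [h4]; exact norm_sub_le _ _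
    _ ≤ 1 * (1 * ‖S‖ ^ 2) + 1 * ‖S‖ := by
      gcongr
      · refine (Matrix.l2_opNorm_mul _ _).trans ?_
        gcongr
        · exact opNorm_isometry_le h₁
        · refine (Matrix.l2_opNorm_mul _ _).trans ?_
          gcongr
          exact opNorm_isometry_le hW
      · refine (Matrix.l2_opNorm_mul _ _).trans ?_
        gcongr
        exact opNorm_isometry_le h₂
    _ ≤ 2 * ‖S‖ := by nlinarith [norm_nonneg S]

/-! ### Truncated singular value decompositions -/

/-- If the first `k` singular values are at least `s > 0`, the frame `Ph` of leading left singular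
vectors is `D R` for a matrix `R` (the leading right singular vectors divided by the singular
values) of norm at most `1 / s`, and the columns of `Dᵀ Ph` are combinations of those of `R`. -/
lemma IsSVD.exists_right_factor {n k T : ℕ} (hkn : k ≤ n) (hkT : k ≤ T)
    {D : Matrix (Fin n) (Fin T) ℝ} {U : Matrix (Fin n) (Fin n) ℝ} {σ : ℕ → ℝ}
    {V : Matrix (Fin T) (Fin T) ℝ} (h : IsSVD D U σ V) {s : ℝ} (hs : 0 < s)
    (hσ : ∀ j < k, s ≤ σ j) :
    ∃ (R : Matrix (Fin T) (Fin k) ℝ) (S : Matrix (Fin k) (Fin k) ℝ),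
      D * R = topColumns hkn U ∧ ((topColumns hkn U)ᵀ * D)ᵀ = R * S ∧ ‖R‖ ≤ 1 / s := by
  set Sig : Matrix (Fin n) (Fin T) ℝ :=
    Matrix.of fun (i : Fin n) (j : Fin T) => if (i : ℕ) = j then σ i else 0 with hSig
  have hDV : D * V = U * Sig := by
    rw [h.eq, Matrix.mul_assoc _ Vᵀ, h.right, Matrix.mul_one]
  have hDU : Dᵀ * U = V * Sigᵀ := by
    rw [h.eq, Matrix.transpose_mul, Matrix.transpose_mul, Matrix.transpose_transpose,
      Matrix.mul_assoc, Matrix.mul_assoc, h.left, Matrix.mul_one]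
  set Vk : Matrix (Fin T) (Fin k) ℝ := V.submatrix id (Fin.castLE hkT) with hVk
  have hVk1 : Vkᵀ * Vk = 1 := by
    ext i j
    have := congrFun (congrFun h.right (Fin.castLE hkT i)) (Fin.castLE hkT j)
    simp only [Matrix.mul_apply, Matrix.transpose_apply, Matrix.one_apply,
      (Fin.castLE_injective hkT).eq_iff] at this
    simpa [hVk, Matrix.mul_apply, Matrix.one_apply] using this
  have hpos : ∀ j : Fin k, 0 < σ j := fun j => hs.trans_le (hσ j j.2)
  refine ⟨Vk * Matrix.diagonal fun j : Fin k => (σ j)⁻¹, Matrix.diagonal fun j : Fin k => σ j ^ 2,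
    ?_, ?_, ?_⟩
  · ext i j
    have h1 := congrFun (congrFun hDV i) (Fin.castLE hkT j)
    have h2 : (U * Sig) i (Fin.castLE hkT j) = U i (Fin.castLE hkn j) * σ j := by
      rw [Matrix.mul_apply, Finset.sum_eq_single (Fin.castLE hkn j)]
      · simp [hSig]
      · intro l _ hl
        have : (l : ℕ) ≠ j := fun hh => hl (Fin.ext hh)
        simp [hSig, this]
      · simp
    rw [← Matrix.mul_assoc, Matrix.mul_diagonal]
    have h3 : (D * Vk) i j = (D * V) i (Fin.castLE hkT j) := rfl
    rw [h3, h1, h2, mul_assoc, mul_inv_cancel₀ (hpos j).ne', mul_one]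
    rfl
  · ext t j
    rw [Matrix.mul_assoc, Matrix.diagonal_mul_diagonal, Matrix.mul_diagonal, Matrix.transpose_mul,
      Matrix.transpose_transpose]
    have h1 := congrFun (congrFun hDU t) (Fin.castLE hkn j)
    have h2 : (V * Sigᵀ) t (Fin.castLE hkn j) = V t (Fin.castLE hkT j) * σ j := by
      rw [Matrix.mul_apply, Finset.sum_eq_single (Fin.castLE hkT j)]
      · simp [hSig]
      · intro l _ hl
        have : (j : ℕ) ≠ l := fun hh => hl (Fin.ext hh.symm)
        simp [hSig, this]
      · simp
    have h3 : (Dᵀ * topColumns hkn U) t j = (Dᵀ * U) t (Fin.castLE hkn j) := rfl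
    rw [h3, h1, h2]
    have := (hpos j).ne'
    simp only [hVk, Matrix.submatrix_apply, id]
    field_simp
  · refine (Matrix.l2_opNorm_mul _ _).trans ?_
    rw [Matrix.l2_opNorm_diagonal, ← one_mul (1 / s)]
    gcongr
    · exact opNorm_isometry_le hVk1
    · rw [pi_norm_le_iff_of_nonneg (by positivity)]
      intro j
      rw [Real.norm_eq_abs, abs_of_pos (inv_pos.2 (hpos j)), one_div]
      exact inv_anti₀ hs (hσ j j.2)

lemma IsSVD.transpose_mul_topColumns {n k T : ℕ} (hkn : k ≤ n)
    {D : Matrix (Fin n) (Fin T) ℝ} {U : Matrix (Fin n) (Fin n) ℝ} {σ : ℕ → ℝ}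
    {V : Matrix (Fin T) (Fin T) ℝ} (h : IsSVD D U σ V) :
    (topColumns hkn U)ᵀ * topColumns hkn U = 1 := by
  ext i j
  have := congrFun (congrFun h.left (Fin.castLE hkn i)) (Fin.castLE hkn j)
  simp only [Matrix.mul_apply, Matrix.transpose_apply, Matrix.one_apply,
    (Fin.castLE_injective hkn).eq_iff] at this
  simpa [topColumns, Matrix.mul_apply, Matrix.one_apply] using this

/-- The max-min characterization of singular values, in one direction: a `k`-dimensional subspace
on which `Dᵀ` expands norms by `L` meets the span of all but the first `k - 1` left singular
vectors. -/
lemma IsSVD.le_singularValue {n k T : ℕ} (hk : 0 < k)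
    {D : Matrix (Fin n) (Fin T) ℝ} {U : Matrix (Fin n) (Fin n) ℝ} {σ : ℕ → ℝ}
    {V : Matrix (Fin T) (Fin T) ℝ} (h : IsSVD D U σ V) {P : Matrix (Fin n) (Fin k) ℝ}
    (hP : Pᵀ * P = 1) {L : ℝ} (hL : ∀ a, L * euclNorm a ≤ euclNorm ((Pᵀ * D)ᵀ *ᵥ a)) :
    L ≤ σ (k - 1) := by
  set Sig : Matrix (Fin n) (Fin T) ℝ :=
    Matrix.of fun (i : Fin n) (j : Fin T) => if (i : ℕ) = j then σ i else 0 with hSig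
  have hkn : k ≤ n := by
    have h1 : Function.Injective P.mulVec := by
      intro x y hxy
      have := congrArg (Pᵀ *ᵥ ·) hxy
      simpa [Matrix.mulVec_mulVec, hP] using this
    have := LinearMap.finrank_le_finrank_of_injective (f := Matrix.mulVecLin P) h1
    simpa using this
  -- `k - 1` linear conditions on a vector with `k` coordinates.
  obtain ⟨a, ha0, ha⟩ : ∃ a : Fin k → ℝ, a ≠ 0 ∧
      ∀ j : Fin n, (j : ℕ) < k - 1 → ((Uᵀ * P) *ᵥ a) j = 0 := by
    let B : Matrix (Fin (k - 1)) (Fin k) ℝ :=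
      (Uᵀ * P).submatrix (Fin.castLE (by omega : k - 1 ≤ n)) id
    have hB : LinearMap.ker (Matrix.mulVecLin B) ≠ ⊥ :=
      LinearMap.ker_ne_bot_of_finrank_lt (by simp; omega)
    obtain ⟨a, ha, ha0⟩ := Submodule.exists_mem_ne_zero_of_ne_bot hB
    refine ⟨a, ha0, fun j hj => ?_⟩
    exact congrFun (LinearMap.mem_ker.1 ha) ⟨j, hj⟩
  set y := (Uᵀ * P) *ᵥ a with hy
  have hUU : Uᵀᵀ * Uᵀ = 1 := by
    rw [Matrix.transpose_transpose]
    exact mul_eq_one_comm.1 h.left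
  have hny : euclNorm y = euclNorm a := by
    rw [hy, ← Matrix.mulVec_mulVec, euclNorm_isometry_mulVec hUU, euclNorm_isometry_mulVec hP]
  have hDy : (Pᵀ * D)ᵀ *ᵥ a = V *ᵥ (Sigᵀ *ᵥ y) := by
    rw [hy, Matrix.mulVec_mulVec, Matrix.mulVec_mulVec, Matrix.transpose_mul,
      Matrix.transpose_transpose, h.eq, Matrix.transpose_mul, Matrix.transpose_mul,
      Matrix.transpose_transpose]
    simp only [hSig, Matrix.mul_assoc]
  have hw : ∀ t : Fin T, (Sigᵀ *ᵥ y) t ^ 2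
      ≤ σ (k - 1) ^ 2 * ∑ l : Fin n, if (l : ℕ) = t then y l ^ 2 else 0 := by
    intro t
    by_cases ht : (t : ℕ) < n
    · have e : ∀ l : Fin n, ((l : ℕ) = t) ↔ l = ⟨t, ht⟩ := fun l => by rw [Fin.ext_iff]
      have h1 : (Sigᵀ *ᵥ y) t = σ t * y ⟨t, ht⟩ := by
        simp [Matrix.mulVec, dotProduct, hSig, e]
      rw [h1]
      simp only [e, Finset.sum_ite_eq', Finset.mem_univ, if_true, mul_pow]
      by_cases htk : (t : ℕ) < k - 1
      · rw [ha ⟨t, ht⟩ htk]; simp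
      · have := h.antitone (not_lt.1 htk)
        gcongr
        exact h.nonneg _
    · have h1 : (Sigᵀ *ᵥ y) t = 0 := by
        have e : ∀ l : Fin n, ¬ ((l : ℕ) = t) := fun l hl => ht (hl ▸ l.2)
        simp [Matrix.mulVec, dotProduct, hSig, e]
      rw [h1]
      have : 0 ≤ ∑ l : Fin n, if (l : ℕ) = t then y l ^ 2 else 0 :=
        Finset.sum_nonneg fun l _ => by split_ifs <;> positivity
      rw [zero_pow two_ne_zero]
      exact mul_nonneg (sq_nonneg _) this
  have hle : euclNorm (Sigᵀ *ᵥ y) ≤ σ (k - 1) * euclNorm y := by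
    refine le_of_sq_le_sq ?_ (mul_nonneg (h.nonneg _) (euclNorm_nonneg _))
    rw [euclNorm_sq, mul_pow, euclNorm_sq]
    refine (Finset.sum_le_sum fun t _ => hw t).trans ?_
    rw [← Finset.mul_sum, Finset.sum_comm]
    gcongr with l _
    by_cases hl : (l : ℕ) < T
    · have e : ∀ t : Fin T, ((l : ℕ) = t) ↔ t = ⟨l, hl⟩ := fun t => by
        rw [Fin.ext_iff]; exact eq_comm
      simp [e]
    · have e : ∀ t : Fin T, ¬ ((l : ℕ) = t) := fun t ht => hl (ht ▸ t.2)
      simp [e, sq_nonneg]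
  have h1 := hL a
  rw [hDy, euclNorm_isometry_mulVec h.right] at h1
  have h2 := h1.trans hle
  rw [hny] at h2
  exact le_of_mul_le_mul_right h2 (euclNorm_pos ha0)

/-! ### The least squares estimator -/

/-- The normal equations: with `X R = 1` and `Xᵀ = R S`, the residual of `M` splits orthogonally
into that of `Y R` and the image of the difference. -/
lemma sum_sq_residual_eq {κ κ' τ : Type*} [Fintype κ] [Fintype κ'] [Fintype τ] [DecidableEq κ]
    {X : Matrix κ τ ℝ} {Y : Matrix κ' τ ℝ} {R : Matrix τ κ ℝ} {S : Matrix κ κ ℝ} (hXR : X * R = 1)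
    (hX : Xᵀ = R * S) (M : Matrix κ' κ ℝ) :
    ∑ i, ∑ t, (Y - M * X) i t ^ 2
      = ∑ i, ∑ t, (Y - Y * R * X) i t ^ 2 + ∑ i, ∑ t, ((M - Y * R) * X) i t ^ 2 := by
  have h1 : (Y - Y * R * X) * Xᵀ = 0 := by
    rw [hX, Matrix.sub_mul, Matrix.mul_assoc _ X, ← Matrix.mul_assoc X, hXR, Matrix.one_mul,
      Matrix.mul_assoc, sub_self]
  have h2 : ∑ i, ∑ t, (Y - Y * R * X) i t * ((M - Y * R) * X) i t = 0 := by
    have : ((Y - Y * R * X) * ((M - Y * R) * X)ᵀ).trace = 0 := by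
      rw [Matrix.transpose_mul, ← Matrix.mul_assoc, h1, Matrix.zero_mul, Matrix.trace_zero]
    rw [← this]
    rfl
  have h3 : Y - M * X = (Y - Y * R * X) - (M - Y * R) * X := by
    rw [Matrix.sub_mul]; abel
  rw [h3]
  have h4 : ∀ a b : ℝ, (a - b) ^ 2 = a ^ 2 + b ^ 2 - 2 * (a * b) := fun a b => by ring
  simp only [Matrix.sub_apply (Y - Y * R * X), h4, Finset.sum_sub_distrib, Finset.sum_add_distrib,
    ← Finset.mul_sum, h2]
  ring

lemma loss_eq {n k : ℕ} (x : ℕ → EuclideanSpace ℝ (Fin n)) (hx : x 0 = 0) (T : ℕ)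
    (Ph : Matrix (Fin n) (Fin k) ℝ) (M : Matrix (Fin k) (Fin k) ℝ) :
    loss x T Ph M = ‖Matrix.toEuclideanLin Phᵀ (x 1)‖ ^ 2 +
      ∑ i, ∑ t, (Phᵀ * dataMatrix (fun t => x (t + 1)) T - M * (Phᵀ * dataMatrix x T)) i t ^ 2 := by
  rw [loss, Finset.sum_range_succ', hx, add_comm]
  simp only [map_zero, sub_zero]
  congr 1
  rw [Finset.sum_range]
  refine Eq.trans (Finset.sum_congr rfl fun t _ => ?_) Finset.sum_comm
  rw [EuclideanSpace.norm_sq_eq]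
  refine Finset.sum_congr rfl fun i _ => ?_
  rw [Real.norm_eq_abs, sq_abs]
  congr 1

/-- With `X = Phᵀ D` right invertible as in `IsSVD.exists_right_factor`, the least squares problem
has exactly one solution. -/
lemma isLeastSquares_iff {n k : ℕ} (x : ℕ → EuclideanSpace ℝ (Fin n)) (hx : x 0 = 0) (T : ℕ)
    {Ph : Matrix (Fin n) (Fin k) ℝ} {R : Matrix (Fin T) (Fin k) ℝ} {S : Matrix (Fin k) (Fin k) ℝ}
    (hPh : Phᵀ * Ph = 1) (hR : dataMatrix x T * R = Ph) (hS : (Phᵀ * dataMatrix x T)ᵀ = R * S)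
    (M : Matrix (Fin k) (Fin k) ℝ) :
    IsLeastSquares x T Ph M ↔ M = Phᵀ * dataMatrix (fun t => x (t + 1)) T * R := by
  set X := Phᵀ * dataMatrix x T with hXdef
  set Y := Phᵀ * dataMatrix (fun t => x (t + 1)) T with hY
  have hXR : X * R = 1 := by rw [hXdef, Matrix.mul_assoc, hR, hPh]
  have key : ∀ M, loss x T Ph M = loss x T Ph (Y * R) +
      ∑ i, ∑ t, ((M - Y * R) * X) i t ^ 2 := by
    intro M
    rw [loss_eq x hx, loss_eq x hx, ← hXdef, ← hY, sum_sq_residual_eq hXR hS M]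
    ring
  have hnn : ∀ M : Matrix (Fin k) (Fin k) ℝ, 0 ≤ ∑ i, ∑ t, ((M - Y * R) * X) i t ^ 2 := fun M =>
    Finset.sum_nonneg fun i _ => Finset.sum_nonneg fun t _ => sq_nonneg _
  constructor
  · intro h
    have h1 := h (Y * R)
    rw [key M] at h1
    have h0 : ∑ i, ∑ t, ((M - Y * R) * X) i t ^ 2 = 0 := le_antisymm (by linarith) (hnn M)
    have h2 : (M - Y * R) * X = 0 := by
      ext i t
      have h3 := (Finset.sum_eq_zero_iff_of_nonneg
        (fun i _ => Finset.sum_nonneg fun t _ => sq_nonneg _)).1 h0 i (Finset.mem_univ i)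
      have h4 := (Finset.sum_eq_zero_iff_of_nonneg (fun t _ => sq_nonneg _)).1 h3 t
        (Finset.mem_univ t)
      exact pow_eq_zero_iff two_ne_zero |>.1 h4
    have h3 : (M - Y * R) * X * R = 0 := by rw [h2, Matrix.zero_mul]
    rw [Matrix.mul_assoc, hXR, Matrix.mul_one] at h3
    exact sub_eq_zero.1 h3
  · rintro rfl M'
    rw [key M']
    linarith [hnn M']

/-! ### Vandermonde matrices of the reciprocal eigenvalues -/

lemma prod_prod_ne_eq_sq {k : ℕ} (f : Fin k → Fin k → ℝ) (hf : ∀ i j, f i j = f j i) :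
    ∏ i, ∏ j, (if i ≠ j then f i j else 1) = (∏ i, ∏ j ∈ Finset.Ioi i, f i j) ^ 2 := by
  have h1 : ∀ i j : Fin k, (if i ≠ j then f i j else 1)
      = (if i < j then f i j else 1) * (if j < i then f j i else 1) := by
    intro i j
    rcases lt_trichotomy i j with h | h | h
    · simp [h, h.ne, h.not_gt]
    · simp [h]
    · simp [h, h.ne', h.not_gt, hf i j]
  have h2 : ∏ i, ∏ j ∈ Finset.Ioi i, f i j = ∏ i, ∏ j, (if i < j then f i j else 1) := by
    refine Finset.prod_congr rfl fun i _ => ?_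
    rw [← Finset.prod_filter]
    congr 1
    ext j
    simp
  simp only [h1, Finset.prod_mul_distrib]
  rw [h2, Finset.prod_comm (f := fun i j => if j < i then f j i else 1), sq]

/-- The gap is the squared Vandermonde determinant of the reciprocal eigenvalues. -/
lemma gap_eq_det_sq {n k : ℕ} (hkn : k ≤ n) (lam : Fin n → ℝ) :
    gap lam k = (Matrix.vandermonde fun i : Fin k => (lam (Fin.castLE hkn i))⁻¹).det ^ 2 := by
  have h1 : ∀ F : Fin n → ℝ, (∀ i : Fin n, k ≤ (i : ℕ) → F i = 1) →
      ∏ i, F i = ∏ i : Fin k, F (Fin.castLE hkn i) := by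
    intro F hF
    refine (Finset.prod_of_injOn (Fin.castLE hkn) (Fin.castLE_injective hkn).injOn
      (by simp) ?_ (fun _ _ => rfl)).symm
    intro i _ hi
    refine hF i (not_lt.1 fun h => hi ⟨⟨i, h⟩, by simp, rfl⟩)
  rw [gap, h1]
  swap
  · intro i hi
    simp [hi.not_gt]
  have h2 : ∀ i : Fin k, (∏ j : Fin n, if ((Fin.castLE hkn i : Fin n) : ℕ) < k ∧ (j : ℕ) < k ∧
      Fin.castLE hkn i ≠ j then (lam (Fin.castLE hkn i))⁻¹ - (lam j)⁻¹ else 1) =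
      ∏ j : Fin k, if i ≠ j then (lam (Fin.castLE hkn i))⁻¹ - (lam (Fin.castLE hkn j))⁻¹
        else 1 := by
    intro i
    rw [h1]
    · simp
    · intro j hj
      simp [hj.not_gt]
  simp only [h2, Finset.abs_prod]
  rw [← sq_abs, Matrix.det_vandermonde]
  simp only [Finset.abs_prod]
  have h3 := prod_prod_ne_eq_sq
    (fun i j : Fin k => |(lam (Fin.castLE hkn j))⁻¹ - (lam (Fin.castLE hkn i))⁻¹|)
    (fun i j => abs_sub_comm _ _)
  rw [← h3]
  refine Finset.prod_congr rfl fun i _ => Finset.prod_congr rfl fun j _ => ?_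
  split_ifs
  · exact abs_sub_comm _ _
  · simp

/-- Hadamard's bound for a matrix with entries in `[-1, 1]`: apply the inequality between the
arithmetic and geometric means to the eigenvalues of `Vᵀ V`. -/
lemma det_sq_le_of_abs_le_one {k : ℕ} (V : Matrix (Fin k) (Fin k) ℝ) (h : ∀ i j, |V i j| ≤ 1) :
    V.det ^ 2 ≤ (k : ℝ) ^ k := by
  rcases Nat.eq_zero_or_pos k with rfl | hk
  · simp
  have hk' : (0 : ℝ) < k := by exact_mod_cast hk
  have hpos : (Vᵀ * V).PosSemidef := by
    have := Matrix.posSemidef_conjTranspose_mul_self V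
    rwa [Matrix.conjTranspose_eq_transpose_of_trivial] at this
  have hdet : V.det ^ 2 = ∏ i, hpos.1.eigenvalues i := by
    have := hpos.1.det_eq_prod_eigenvalues
    rw [Matrix.det_mul, Matrix.det_transpose] at this
    simpa [sq] using this
  have htr : ∑ i, hpos.1.eigenvalues i ≤ (k : ℝ) * k := by
    have h1 := hpos.1.trace_eq_sum_eigenvalues
    have h2 : (Vᵀ * V).trace = ∑ i, ∑ j, V j i * V j i := rfl
    have h3 : ∑ i : Fin k, ∑ j : Fin k, V j i * V j i ≤ ∑ _i : Fin k, ∑ _j : Fin k, (1 : ℝ) := by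
      refine Finset.sum_le_sum fun i _ => Finset.sum_le_sum fun j _ => ?_
      have := (sq_le_one_iff_abs_le_one (V j i)).2 (h j i)
      nlinarith
    have h4 : ∑ i, hpos.1.eigenvalues i = (Vᵀ * V).trace := by simpa using h1.symm
    rw [h4, h2]
    simpa using h3
  have hnn : ∀ i, 0 ≤ hpos.1.eigenvalues i := hpos.eigenvalues_nonneg
  have hamgm := Real.geom_mean_le_arith_mean Finset.univ (fun _ : Fin k => (1 : ℝ))
    hpos.1.eigenvalues (by simp) (by simpa using hk) (fun i _ => hnn i)
  simp only [Real.rpow_one, one_mul, Finset.sum_const, Finset.card_univ, Fintype.card_fin,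
    nsmul_eq_mul, mul_one] at hamgm
  have h5 : (∏ i, hpos.1.eigenvalues i) ^ ((k : ℝ)⁻¹) ≤ k := by
    refine hamgm.trans ?_
    rw [div_le_iff₀ hk']
    exact htr
  have h6 := pow_le_pow_left₀
    (Real.rpow_nonneg (Finset.prod_nonneg fun i _ => hnn i) _) h5 k
  rw [hdet]
  rwa [Real.rpow_inv_natCast_pow (Finset.prod_nonneg fun i _ => hnn i) hk.ne'] at h6

/-- The Vandermonde determinant of points in `[-ρ, ρ]`. -/
lemma det_vandermonde_sq_le {k : ℕ} {v : Fin k → ℝ} {ρ : ℝ} (hρ : 0 < ρ) (hv : ∀ i, |v i| ≤ ρ) :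
    (Matrix.vandermonde v).det ^ 2 ≤ (k : ℝ) ^ k * ρ ^ (k * (k - 1)) := by
  have h1 : Matrix.vandermonde v
      = Matrix.vandermonde (fun i => v i / ρ) * Matrix.diagonal fun j : Fin k => ρ ^ (j : ℕ) := by
    ext i j
    rw [Matrix.mul_diagonal, Matrix.vandermonde_apply, Matrix.vandermonde_apply, div_pow,
      div_mul_cancel₀ _ (pow_pos hρ _).ne']
  have h2 : (∏ j : Fin k, ρ ^ (j : ℕ)) ^ 2 = ρ ^ (k * (k - 1)) := by
    rw [Finset.prod_pow_eq_pow_sum, ← pow_mul, Fin.sum_univ_eq_sum_range (fun i => i),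
      Finset.sum_range_id_mul_two]
  rw [h1, Matrix.det_mul, Matrix.det_diagonal, mul_pow, h2]
  gcongr
  refine det_sq_le_of_abs_le_one _ fun i j => ?_
  rw [Matrix.vandermonde_apply, abs_pow, abs_div, abs_of_pos hρ]
  exact pow_le_one₀ (by positivity) ((div_le_one hρ).2 (hv i))

/-- By Cramer's rule. -/
lemma abs_inv_apply_le {k : ℕ} {V : Matrix (Fin k) (Fin k) ℝ} (h : ∀ i j, |V i j| ≤ 1)
    (i j : Fin k) : |V⁻¹ i j| ≤ k.factorial / |V.det| := by
  rw [Matrix.inv_def, Matrix.smul_apply, Ring.inverse_eq_inv', smul_eq_mul, abs_mul, abs_inv,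
    div_eq_inv_mul]
  gcongr
  rw [Matrix.adjugate_apply]
  have := Matrix.det_le (A := V.updateRow j (Pi.single i 1)) (abv := AbsoluteValue.abs) (x := 1) ?_
  · simpa using this
  · intro a b
    rw [Matrix.updateRow_apply]
    split_ifs
    · by_cases hb : b = i
      · subst hb; simp
      · simp [hb]
    · exact h a b

/-- A bound `‖Mᵗ‖ ≤ ζ bᵗ` for a `k × k` matrix with distinct eigenvalues of modulus in `[1, a]` can
be improved to the exact rate `aᵗ`, at the cost of a larger constant: interpolate `λᵗ` on the
spectrum by a polynomial of degree less than `k`, so that only the first `k` powers matter. -/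
lemma norm_pow_le_of_isJordanForm {k : ℕ} {M Pbar : Matrix (Fin k) (Fin k) ℝ} {lam : Fin k → ℝ}
    (hM : IsJordanForm M lam Pbar) {a b ζ : ℝ} (hlam : ∀ i, 1 ≤ |lam i|) (ha : ∀ i, |lam i| ≤ a)
    (hb : 1 ≤ b) (hζ : ∀ t : ℕ, ‖M ^ t‖ ≤ ζ * b ^ t)
    (hdet : (Matrix.vandermonde fun i => (lam i)⁻¹).det ≠ 0) (t : ℕ) :
    ‖M ^ t‖ ≤ k * (k * k.factorial / |(Matrix.vandermonde fun i => (lam i)⁻¹).det|) * ζ * b ^ k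
      * a ^ t := by
  set V := Matrix.vandermonde fun i => (lam i)⁻¹ with hV
  have hlam0 : ∀ i, lam i ≠ 0 := fun i h => by
    have := hlam i
    rw [h] at this
    norm_num at this
  have hinv : ∀ i, |(lam i)⁻¹| ≤ 1 := fun i => by
    rw [abs_inv]
    exact inv_le_one_of_one_le₀ (hlam i)
  have hVe : ∀ i j, |V i j| ≤ 1 := fun i j => by
    rw [hV, Matrix.vandermonde_apply, abs_pow]
    exact pow_le_one₀ (abs_nonneg _) (hinv i)
  have hζ0 : 0 ≤ ζ := by
    have := (norm_nonneg _).trans (hζ 0)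
    simpa using this
  set w : Fin k → ℝ := fun i => lam i ^ t * (lam i)⁻¹ ^ (k - 1) with hw
  set c := V⁻¹ *ᵥ w with hc
  have hVc : V *ᵥ c = w := by
    rw [hc, Matrix.mulVec_mulVec, Matrix.mul_nonsing_inv _ (isUnit_iff_ne_zero.2 hdet),
      Matrix.one_mulVec]
  have hwa : ∀ i, |w i| ≤ a ^ t := fun i => by
    rw [hw, abs_mul, abs_pow, abs_pow]
    calc |lam i| ^ t * |(lam i)⁻¹| ^ (k - 1) ≤ a ^ t * 1 := by
          have := (abs_nonneg _).trans (ha i)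
          gcongr
          · exact ha i
          · exact pow_le_one₀ (abs_nonneg _) (hinv i)
      _ = a ^ t := mul_one _
  have hca : ∀ j, |c j| ≤ k * k.factorial / |V.det| * a ^ t := fun j => by
    have h0 : c j = ∑ i, V⁻¹ j i * w i := rfl
    calc |c j| ≤ ∑ i, |V⁻¹ j i * w i| := by rw [h0]; exact Finset.abs_sum_le_sum_abs _ _
      _ ≤ ∑ _i : Fin k, k.factorial / |V.det| * a ^ t := by
          refine Finset.sum_le_sum fun i _ => ?_
          rw [abs_mul]
          gcongr
          · exact abs_inv_apply_le hVe j i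
          · exact hwa i
      _ = _ := by simp; ring
  have hinterp : ∀ i, ∑ j : Fin k, c j * lam i ^ (k - 1 - (j : ℕ)) = lam i ^ t := by
    intro i
    have h1 : ∑ j : Fin k, (lam i)⁻¹ ^ (j : ℕ) * c j = lam i ^ t * (lam i)⁻¹ ^ (k - 1) :=
      congrFun hVc i
    have h2 : ∀ j : Fin k, c j * lam i ^ (k - 1 - (j : ℕ))
        = lam i ^ (k - 1) * ((lam i)⁻¹ ^ (j : ℕ) * c j) := fun j => by
      rw [pow_sub₀ _ (hlam0 i) (by omega : (j : ℕ) ≤ k - 1), inv_pow]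
      ring
    simp only [h2]
    rw [← Finset.mul_sum, h1, inv_pow]
    field_simp [hlam0 i]
  have hpow : ∀ s : ℕ, M ^ s = Pbar⁻¹ * Matrix.diagonal (fun i => lam i ^ s) * Pbar := by
    intro s
    induction s with
    | zero => simp [Matrix.nonsing_inv_mul _ hM.isUnit]
    | succ s ih =>
      rw [pow_succ, ih]
      rw [hM.eq]
      rw [Matrix.mul_assoc _ Pbar, Matrix.mul_assoc _ _ Pbar, ← Matrix.mul_assoc Pbar,
        Matrix.mul_nonsing_inv _ hM.isUnit, Matrix.one_mul, Matrix.mul_assoc, ← Matrix.mul_assoc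
        (Matrix.diagonal _), Matrix.diagonal_mul_diagonal, Matrix.mul_assoc]
      simp only [pow_succ]
  have hsum : M ^ t = ∑ j : Fin k, c j • M ^ (k - 1 - (j : ℕ)) := by
    have h1 : ∀ s : ℕ, ∀ r : ℝ, r • M ^ s
        = Pbar⁻¹ * (r • Matrix.diagonal (fun i => lam i ^ s)) * Pbar := fun s r => by
      rw [hpow, Matrix.mul_smul, Matrix.smul_mul]
    simp only [h1]
    rw [hpow, ← Finset.sum_mul, ← Finset.mul_sum]
    congr 2
    ext i j
    rw [Matrix.sum_apply]
    by_cases hij : i = j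
    · subst hij
      simp [hinterp i]
    · simp [hij]
  calc ‖M ^ t‖ ≤ ∑ j : Fin k, ‖c j • M ^ (k - 1 - (j : ℕ))‖ := by
        rw [hsum]; exact norm_sum_le _ _
    _ ≤ ∑ _j : Fin k, (k * k.factorial / |V.det| * a ^ t) * (ζ * b ^ k) := by
        refine Finset.sum_le_sum fun j _ => ?_
        rw [norm_smul, Real.norm_eq_abs]
        have : 0 ≤ a ^ t := (abs_nonneg _).trans (hwa j)
        gcongr
        · exact hca j
        · refine (hζ _).trans ?_
          exact mul_le_mul_of_nonneg_left (pow_le_pow_right₀ hb (by omega)) hζ0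
    _ = _ := by simp; ring

/-! ### The unstable subspace and the block structure -/

lemma mul_transpose_add_eq_one {n k m : ℕ} (hn : k + m = n) {P₁ : Matrix (Fin n) (Fin k) ℝ}
    {P₂ : Matrix (Fin n) (Fin m) ℝ} (h₁ : P₁ᵀ * P₁ = 1) (h₂ : P₂ᵀ * P₂ = 1) (h₁₂ : P₁ᵀ * P₂ = 0) :
    P₁ * P₁ᵀ + P₂ * P₂ᵀ = 1 := by
  have h₂₁ : P₂ᵀ * P₁ = 0 := by
    have := congrArg Matrix.transpose h₁₂
    simpa [Matrix.transpose_mul] using this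
  rw [← Matrix.fromCols_mul_fromRows]
  refine (Matrix.mul_eq_one_comm_of_card_eq _ _ _ (by simp [hn])).2 ?_
  rw [Matrix.fromRows_mul_fromCols, h₁, h₂, h₁₂, h₂₁, Matrix.fromBlocks_one]

lemma IsOrthonormalBasisOf.mulVec_eq {n k : ℕ} {P : Matrix (Fin n) (Fin k) ℝ}
    {E : Submodule ℝ (Fin n → ℝ)} (h : IsOrthonormalBasisOf P E) {y : Fin n → ℝ} (hy : y ∈ E) :
    P *ᵥ (Pᵀ *ᵥ y) = y := by
  rw [← h.2] at hy
  have hr : y ∈ LinearMap.range P.mulVecLin := by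
    rw [Matrix.range_mulVecLin]
    exact hy
  obtain ⟨x, rfl⟩ := hr
  rw [Matrix.mulVecLin_apply, Matrix.mulVec_mulVec (M := Pᵀ), h.1, Matrix.one_mulVec]

lemma mulVec_mem_unstableSubspace {n : ℕ} {A : Matrix (Fin n) (Fin n) ℝ} {lam : Fin n → ℝ} {k : ℕ}
    {y : Fin n → ℝ} (hy : y ∈ unstableSubspace A lam k) : A *ᵥ y ∈ unstableSubspace A lam k := by
  have : unstableSubspace A lam k ≤ (unstableSubspace A lam k).comap (Matrix.toLin' A) := by
    refine iSup₂_le fun i hi x hx => ?_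
    have hx' := Module.End.mem_eigenspace_iff.1 hx
    rw [Submodule.mem_comap, hx']
    exact Submodule.smul_mem _ _ (Submodule.mem_iSup_of_mem i (Submodule.mem_iSup_of_mem hi hx))
  exact this hy

lemma IsOrthonormalBasisOf.col_mem {n k : ℕ} {P : Matrix (Fin n) (Fin k) ℝ}
    {E : Submodule ℝ (Fin n → ℝ)} (h : IsOrthonormalBasisOf P E) (j : Fin k) : Pᵀ j ∈ E :=
  h.2 ▸ Submodule.subset_span ⟨j, rfl⟩

/-- `E_u` is invariant, so `A P = P M` with `M = Pᵀ A P`. -/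
lemma IsOrthonormalBasisOf.mul_block {n k : ℕ} {A : Matrix (Fin n) (Fin n) ℝ} {lam : Fin n → ℝ}
    {P : Matrix (Fin n) (Fin k) ℝ} (h : IsOrthonormalBasisOf P (unstableSubspace A lam k)) :
    A * P = P * block A P := by
  ext i j
  have h1 := h.mulVec_eq (mulVec_mem_unstableSubspace (h.col_mem j))
  have h2 := congrFun h1 i
  rw [Matrix.mulVec_mulVec, Matrix.mulVec_mulVec] at h2
  rw [block, ← Matrix.mul_assoc, ← Matrix.mul_assoc]
  exact h2.symm

lemma IsOrthonormalBasisOf.transpose_mul_complement {n k m : ℕ} {A : Matrix (Fin n) (Fin n) ℝ}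
    {lam : Fin n → ℝ} {P₁ : Matrix (Fin n) (Fin k) ℝ} {P₂ : Matrix (Fin n) (Fin m) ℝ}
    (h₁ : IsOrthonormalBasisOf P₁ (unstableSubspace A lam k)) (h₁₂ : P₁ᵀ * P₂ = 0)
    (hone : P₁ * P₁ᵀ + P₂ * P₂ᵀ = 1) : P₂ᵀ * A = block A P₂ * P₂ᵀ := by
  have h₂₁ : P₂ᵀ * P₁ = 0 := by
    have := congrArg Matrix.transpose h₁₂
    simpa [Matrix.transpose_mul] using this
  have h : P₂ᵀ * A * (P₁ * P₁ᵀ) = 0 := by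
    rw [Matrix.mul_assoc, ← Matrix.mul_assoc A, h₁.mul_block, Matrix.mul_assoc,
      ← Matrix.mul_assoc P₂ᵀ, h₂₁, Matrix.zero_mul]
  calc P₂ᵀ * A = P₂ᵀ * A * (P₁ * P₁ᵀ + P₂ * P₂ᵀ) := by rw [hone, Matrix.mul_one]
    _ = block A P₂ * P₂ᵀ := by rw [Matrix.mul_add, h, zero_add, block, ← Matrix.mul_assoc]

lemma IsOrthonormalBasisOf.block_pow {n k : ℕ} {A : Matrix (Fin n) (Fin n) ℝ} {lam : Fin n → ℝ}
    {P : Matrix (Fin n) (Fin k) ℝ} (h : IsOrthonormalBasisOf P (unstableSubspace A lam k)) (t : ℕ) :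
    block A P ^ t = Pᵀ * A ^ t * P := by
  have h1 : A ^ t * P = P * block A P ^ t := by
    induction t with
    | zero => simp
    | succ t ih =>
      rw [pow_succ, Matrix.mul_assoc, h.mul_block, ← Matrix.mul_assoc, ih, Matrix.mul_assoc,
        ← pow_succ]
  rw [Matrix.mul_assoc, h1, ← Matrix.mul_assoc, h.1, Matrix.one_mul]

lemma norm_conj_le {ι κ : Type*} [Fintype ι] [Fintype κ] [DecidableEq ι] [DecidableEq κ]
    {P : Matrix ι κ ℝ} (hP : Pᵀ * P = 1) (X : Matrix ι ι ℝ) : ‖Pᵀ * X * P‖ ≤ ‖X‖ := by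
  have h1 := opNorm_isometry_le hP
  have h2 : ‖Pᵀ‖ ≤ 1 := by rwa [opNorm_transpose]
  calc ‖Pᵀ * X * P‖ ≤ ‖Pᵀ * X‖ * ‖P‖ := Matrix.l2_opNorm_mul _ _
    _ ≤ (‖Pᵀ‖ * ‖X‖) * ‖P‖ := by gcongr; exact Matrix.l2_opNorm_mul _ _
    _ ≤ (1 * ‖X‖) * 1 := by gcongr
    _ = ‖X‖ := by ring

lemma IsOrthonormalBasisOf.mul_rotation {n k : ℕ} {P : Matrix (Fin n) (Fin k) ℝ}
    {E : Submodule ℝ (Fin n → ℝ)} (hP : IsOrthonormalBasisOf P E) {W : Matrix (Fin k) (Fin k) ℝ}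
    (hW : Wᵀ * W = 1) : IsOrthonormalBasisOf (P * W) E := by
  refine ⟨?_, ?_⟩
  · rw [Matrix.transpose_mul, Matrix.mul_assoc, ← Matrix.mul_assoc Pᵀ, hP.1, Matrix.one_mul, hW]
  · have hrange : ∀ X : Matrix (Fin n) (Fin k) ℝ,
        Submodule.span ℝ (Set.range Xᵀ) = LinearMap.range X.mulVecLin := fun X => by
      rw [Matrix.range_mulVecLin]; rfl
    rw [← hP.2, hrange, hrange, Matrix.mulVecLin_mul]
    refine LinearMap.range_comp_of_range_eq_top _ (LinearMap.range_eq_top.2 fun y => ?_)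
    refine ⟨Wᵀ *ᵥ y, ?_⟩
    rw [Matrix.mulVecLin_apply, Matrix.mulVec_mulVec, mul_eq_one_comm.1 hW, Matrix.one_mulVec]

/-! ### Spectral radii -/

lemma specRad_nonneg {m : ℕ} (X : Matrix (Fin m) (Fin m) ℝ) : 0 ≤ specRad X :=
  ENNReal.toReal_nonneg

lemma specRad_le_of_charpoly {m : ℕ} {ι : Type*} {X : Matrix (Fin m) (Fin m) ℝ} {s : Finset ι}
    {μ : ι → ℝ} (hX : X.charpoly = ∏ i ∈ s, (Polynomial.X - Polynomial.C (μ i))) {b : ℝ}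
    (hb : 0 ≤ b) (h : ∀ i ∈ s, |μ i| ≤ b) : specRad X ≤ b := by
  refine ENNReal.toReal_le_of_le_ofReal hb (iSup₂_le fun z hz => ?_)
  rw [Matrix.mem_spectrum_iff_isRoot_charpoly, Matrix.charpoly_map, hX, Polynomial.map_prod,
    Polynomial.IsRoot.def, Polynomial.eval_prod, Finset.prod_eq_zero_iff] at hz
  obtain ⟨i, hi, hz⟩ := hz
  simp only [Polynomial.map_sub, Polynomial.map_X, Polynomial.map_C, Polynomial.eval_sub,
    Polynomial.eval_X, Polynomial.eval_C, sub_eq_zero] at hz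
  rw [hz]
  change ‖algebraMap ℝ ℂ (μ i)‖ₑ ≤ _
  rw [← ofReal_norm]
  refine ENNReal.ofReal_le_ofReal ?_
  simpa using h i hi

lemma IsGelfandConst.norm_pow_le {m : ℕ} {X : Matrix (Fin m) (Fin m) ℝ} {ε ζ b : ℝ}
    (h : IsGelfandConst X ε ζ) (hε : 0 < ε) (hb : specRad X ≤ b) (t : ℕ) :
    ‖X ^ t‖ ≤ ζ * (b + ε) ^ t := by
  have hζ : 0 ≤ ζ := by simpa using (norm_nonneg _).trans (h 0)
  have := specRad_nonneg X
  refine (h t).trans ?_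
  gcongr

/-- `A` is block triangular in the decomposition `E_u ⊕ E_u^⊥`, so the eigenvalues of `M₂` are the
stable ones. -/
lemma charpoly_block_stable {n k m : ℕ} (hn : k + m = n) {A : Matrix (Fin n) (Fin n) ℝ}
    {lam : Fin n → ℝ} (hA : SpectralAssumption A lam k) {P₁ : Matrix (Fin n) (Fin k) ℝ}
    {P₂ : Matrix (Fin n) (Fin m) ℝ} (h₁ : IsOrthonormalBasisOf P₁ (unstableSubspace A lam k))
    (h₂ : P₂ᵀ * P₂ = 1) (h₁₂ : P₁ᵀ * P₂ = 0) {Pbar : Matrix (Fin k) (Fin k) ℝ}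
    (hJ : IsJordanForm (block A P₁) (fun i => lam (Fin.castLE (by omega) i)) Pbar) :
    (block A P₂).charpoly = ∏ i ∈ Finset.univ.filter (fun i : Fin n => k ≤ (i : ℕ)),
      (Polynomial.X - Polynomial.C (lam i)) := by
  have h₂₁ : P₂ᵀ * P₁ = 0 := by
    have := congrArg Matrix.transpose h₁₂
    simpa [Matrix.transpose_mul] using this
  have hone := mul_transpose_add_eq_one hn h₁.1 h₂ h₁₂
  have hM1 : (block A P₁).charpoly
      = ∏ i : Fin k, (Polynomial.X - Polynomial.C (lam (Fin.castLE (by omega) i))) := by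
    rw [hJ.eq, Matrix.charpoly_mul_comm, ← Matrix.mul_assoc, Matrix.mul_nonsing_inv _ hJ.isUnit,
      Matrix.one_mul, Matrix.charpoly_diagonal]
  have hprod : A.charpoly = (block A P₁).charpoly * (block A P₂).charpoly := by
    rw [← Matrix.charpoly_fromBlocks_zero₂₁ _ (P₁ᵀ * A * P₂)]
    have h3 : Matrix.fromBlocks (block A P₁) (P₁ᵀ * A * P₂) 0 (block A P₂)
        = (Matrix.fromRows P₁ᵀ P₂ᵀ) * (A * Matrix.fromCols P₁ P₂) := by
      rw [Matrix.mul_fromCols, Matrix.fromRows_mul_fromCols, h₁.mul_block]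
      simp only [block, ← Matrix.mul_assoc, h₁.1, h₂₁, Matrix.zero_mul, Matrix.one_mul]
    rw [h3, Matrix.charpoly_mul_comm_of_le _ _ (by simp [hn]), Matrix.mul_assoc,
      Matrix.fromCols_mul_fromRows, hone, Matrix.mul_one]
    simp [hn]
  have hsplit : ∏ i : Fin n, (Polynomial.X - Polynomial.C (lam i))
      = (∏ i : Fin k, (Polynomial.X - Polynomial.C (lam (Fin.castLE (by omega) i)))) *
        ∏ i ∈ Finset.univ.filter (fun i : Fin n => k ≤ (i : ℕ)),
          (Polynomial.X - Polynomial.C (lam i)) := by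
    rw [← Finset.prod_filter_not_mul_prod_filter Finset.univ (fun i : Fin n => k ≤ (i : ℕ))]
    congr 1
    symm
    refine Finset.prod_of_injOn (Fin.castLE (by omega)) (Fin.castLE_injective _).injOn
      (fun i _ => by simp) ?_ (fun _ _ => rfl)
    intro i hi hi'
    exact absurd ⟨⟨i, by simpa using hi⟩, by simp, rfl⟩ hi'
  have hne : (block A P₁).charpoly ≠ 0 := (Matrix.charpoly_monic _).ne_zero
  refine mul_left_cancel₀ hne ?_
  rw [← hprod, hA.charpoly_eq, hsplit, hM1]

/-! ### The trajectory in stable and unstable coordinates -/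

lemma opNorm_le_of_euclNorm_col_le {m T : ℕ} (X : Matrix (Fin m) (Fin T) ℝ) {b : ℝ} (hb : 0 ≤ b)
    (h : ∀ t, euclNorm (fun i => X i t) ≤ b) : ‖X‖ ≤ T * b := by
  refine le_of_sq_le_sq ((opNorm_sq_le_sum X).trans ?_) (by positivity)
  rw [Finset.sum_comm]
  calc ∑ t, ∑ i, X i t ^ 2 ≤ ∑ _t : Fin T, b ^ 2 := by
        refine Finset.sum_le_sum fun t _ => ?_
        have := pow_le_pow_left₀ (euclNorm_nonneg _) (h t) 2
        rwa [euclNorm_sq] at this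
    _ = T * b ^ 2 := by simp
    _ ≤ (T : ℝ) ^ 2 * b ^ 2 := by
        have : (T : ℝ) ≤ (T : ℝ) ^ 2 := by exact_mod_cast Nat.le_self_pow two_ne_zero T
        gcongr
    _ = (T * b) ^ 2 := by ring

lemma state_succ {n : ℕ} (A : Matrix (Fin n) (Fin n) ℝ) (η : ℕ → EuclideanSpace ℝ (Fin n))
    (t : ℕ) :
    (state A η (t + 1)).ofLp = A *ᵥ (state A η t).ofLp + (η t).ofLp := by
  simp [state, Matrix.toLpLin_apply]

lemma euclNorm_transpose_mulVec_le {ι κ : Type*} [Fintype ι] [Fintype κ] [DecidableEq ι]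
    [DecidableEq κ] {P : Matrix ι κ ℝ} (hP : Pᵀ * P = 1) (x : ι → ℝ) :
    euclNorm (Pᵀ *ᵥ x) ≤ euclNorm x := by
  refine (euclNorm_mulVec_le _ _).trans ?_
  have : ‖Pᵀ‖ ≤ 1 := by rw [opNorm_transpose]; exact opNorm_isometry_le hP
  nlinarith [euclNorm_nonneg x]

/-- The stable coordinates of the trajectory stay bounded. -/
lemma euclNorm_stable_le {n m : ℕ} {A : Matrix (Fin n) (Fin n) ℝ} {P₂ : Matrix (Fin n) (Fin m) ℝ}
    (h₂ : P₂ᵀ * P₂ = 1) (hA : P₂ᵀ * A = block A P₂ * P₂ᵀ) {η : ℕ → EuclideanSpace ℝ (Fin n)}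
    {C ζ q : ℝ} (hη : ∀ t, ‖η t‖ ≤ C) (hq0 : 0 ≤ q) (hq1 : q < 1)
    (hζ : ∀ t : ℕ, ‖block A P₂ ^ t‖ ≤ ζ * q ^ t) (t : ℕ) :
    euclNorm (P₂ᵀ *ᵥ (state A η t).ofLp) ≤ ζ * C / (1 - q) := by
  have hC : 0 ≤ C := (norm_nonneg _).trans (hη 0)
  have hζ0 : 0 ≤ ζ := by simpa using (norm_nonneg _).trans (hζ 0)
  have key : ∀ j : ℕ, euclNorm (block A P₂ ^ j *ᵥ (P₂ᵀ *ᵥ (state A η t).ofLp))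
      ≤ ∑ i ∈ Finset.range t, ζ * q ^ (i + j) * C := by
    induction t with
    | zero =>
      intro j
      have : (state A η 0).ofLp = 0 := rfl
      simp [this, euclNorm]
    | succ t ih =>
      intro j
      have h1 : block A P₂ ^ j *ᵥ (P₂ᵀ *ᵥ (state A η (t + 1)).ofLp)
          = block A P₂ ^ (j + 1) *ᵥ (P₂ᵀ *ᵥ (state A η t).ofLp)
            + block A P₂ ^ j *ᵥ (P₂ᵀ *ᵥ (η t).ofLp) := by
        rw [state_succ, Matrix.mulVec_add, Matrix.mulVec_add, Matrix.mulVec_mulVec (M := P₂ᵀ), hA,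
          pow_succ, ← Matrix.mulVec_mulVec _ (block A P₂ ^ j),
          ← Matrix.mulVec_mulVec _ (block A P₂)]
      rw [h1, Finset.sum_range_succ']
      refine (euclNorm_add_le _ _).trans ?_
      gcongr
      · refine (ih (j + 1)).trans_eq (Finset.sum_congr rfl fun i _ => ?_)
        rw [show i + (j + 1) = i + 1 + j by omega]
      · refine (euclNorm_mulVec_le _ _).trans ?_
        have h2 : euclNorm (P₂ᵀ *ᵥ (η t).ofLp) ≤ C :=
          (euclNorm_transpose_mulVec_le h₂ _).trans (hη t)
        have h3 := hζ j
        rw [zero_add]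
        gcongr
        exact euclNorm_nonneg _
  have h0 := key 0
  simp only [pow_zero, Matrix.one_mulVec, add_zero] at h0
  refine h0.trans ?_
  rw [← Finset.sum_mul, ← Finset.mul_sum]
  have h4 : ∑ i ∈ Finset.range t, q ^ i ≤ (1 - q)⁻¹ := by
    rw [← tsum_geometric_of_lt_one hq0 hq1]
    exact (summable_geometric_of_lt_one hq0 hq1).sum_le_tsum _ fun i _ => pow_nonneg hq0 i
  calc ζ * (∑ i ∈ Finset.range t, q ^ i) * C ≤ ζ * (1 - q)⁻¹ * C := by gcongr
    _ = _ := by rw [div_eq_mul_inv]; ring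

/-- Solving `v (t + 1) = l v t + O(b)`, `|l| ≥ a > 1`, backwards in time. -/
lemma abs_sub_inv_pow_mul_le {v : ℕ → ℝ} {l a b : ℝ} (ha : 1 < a) (hl : a ≤ |l|)
    (hv : ∀ t, |v (t + 1) - l * v t| ≤ b) (t j : ℕ) :
    |v t - l⁻¹ ^ j * v (t + j)| ≤ b / (a - 1) := by
  have hb : 0 ≤ b := (abs_nonneg _).trans (hv 0)
  have ha0 : 0 < a := by linarith
  have hl0 : l ≠ 0 := fun h => by rw [h, abs_zero] at hl; linarith
  have ha1 : a - 1 ≠ 0 := by linarith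
  have key : |v t - l⁻¹ ^ j * v (t + j)| ≤ b / (a - 1) * (1 - a⁻¹ ^ j) := by
    induction j with
    | zero => simp
    | succ j ih =>
      have h1 : v t - l⁻¹ ^ (j + 1) * v (t + (j + 1))
          = (v t - l⁻¹ ^ j * v (t + j)) - l⁻¹ ^ (j + 1) * (v (t + j + 1) - l * v (t + j)) := by
        rw [← add_assoc, pow_succ]
        field_simp
        ring
      have h2 : |l⁻¹ ^ (j + 1) * (v (t + j + 1) - l * v (t + j))| ≤ a⁻¹ ^ (j + 1) * b := by
        rw [abs_mul, abs_pow, abs_inv]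
        gcongr
        exact hv _
      calc |v t - l⁻¹ ^ (j + 1) * v (t + (j + 1))|
          ≤ b / (a - 1) * (1 - a⁻¹ ^ j) + a⁻¹ ^ (j + 1) * b := by
            rw [h1]
            exact (abs_sub _ _).trans (add_le_add ih h2)
        _ = b / (a - 1) * (1 - a⁻¹ ^ (j + 1)) := by
            rw [pow_succ]
            field_simp
            ring
  refine key.trans (mul_le_of_le_one_right (div_nonneg hb (by linarith)) ?_)
  have : 0 ≤ a⁻¹ ^ j := by positivity
  linarith

lemma IsJordanForm.mul_eq {k : ℕ} {M Pbar : Matrix (Fin k) (Fin k) ℝ} {lam : Fin k → ℝ}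
    (h : IsJordanForm M lam Pbar) : Pbar * M = Matrix.diagonal lam * Pbar := by
  rw [h.eq, ← Matrix.mul_assoc, ← Matrix.mul_assoc, Matrix.mul_nonsing_inv _ h.isUnit,
    Matrix.one_mul]

lemma IsJordanForm.abs_mulVec_le {k : ℕ} {M Pbar : Matrix (Fin k) (Fin k) ℝ} {lam : Fin k → ℝ}
    (h : IsJordanForm M lam Pbar) (u : Fin k → ℝ) (i : Fin k) : |(Pbar *ᵥ u) i| ≤ euclNorm u := by
  refine abs_le_of_sq_le_sq ?_ (euclNorm_nonneg _)
  have h1 : (∑ j, Pbar i j * u j) ^ 2 ≤ (∑ j, Pbar i j ^ 2) * ∑ j, u j ^ 2 :=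
    Finset.sum_mul_sq_le_sq_mul_sq _ _ _
  rw [h.unit_row, one_mul] at h1
  rw [euclNorm_sq]
  exact h1

lemma IsJordanForm.norm_le {k : ℕ} {M Pbar : Matrix (Fin k) (Fin k) ℝ} {lam : Fin k → ℝ}
    (h : IsJordanForm M lam Pbar) : ‖Pbar‖ ≤ k := by
  rw [← mul_one (k : ℝ)]
  refine opNorm_le_of_abs_entry_le _ zero_le_one fun i j => ?_
  rw [← sq_le_one_iff_abs_le_one, ← h.unit_row i]
  exact Finset.single_le_sum (f := fun j => Pbar i j ^ 2) (fun j _ => sq_nonneg _)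
    (Finset.mem_univ j)

/-- The rescaled coordinates `P̄ z_t` are `λ_i^{-t}` times the coordinates `P̄ P₁ᵀ x_t`. -/
lemma mulVec_zCoord {n k : ℕ} {A : Matrix (Fin n) (Fin n) ℝ} {P₁ : Matrix (Fin n) (Fin k) ℝ}
    {lam : Fin k → ℝ} {Pbar : Matrix (Fin k) (Fin k) ℝ} (h : IsJordanForm (block A P₁) lam Pbar)
    (hlam : ∀ i, lam i ≠ 0) (η : ℕ → EuclideanSpace ℝ (Fin n)) (t : ℕ) (i : Fin k) :
    (Pbar *ᵥ (P₁ᵀ *ᵥ (state A η t).ofLp)) i = lam i ^ t * (Pbar *ᵥ zCoord A P₁ η t) i := by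
  set M := block A P₁ with hM
  have hMu : IsUnit M.det := by
    have := congrArg Matrix.det h.mul_eq
    rw [Matrix.det_mul, Matrix.det_mul, mul_comm] at this
    rw [mul_right_cancel₀ h.isUnit.ne_zero this, Matrix.det_diagonal, isUnit_iff_ne_zero]
    exact Finset.prod_ne_zero_iff.2 fun i _ => hlam i
  have hpow : Pbar * M ^ t = Matrix.diagonal (fun i => lam i ^ t) * Pbar := by
    induction t with
    | zero => simp
    | succ t ih =>
      rw [pow_succ, ← Matrix.mul_assoc, ih, Matrix.mul_assoc, h.mul_eq, ← Matrix.mul_assoc,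
        Matrix.diagonal_mul_diagonal]
      simp only [pow_succ]
  have hMM : M ^ t * M⁻¹ ^ t = 1 := by
    rw [Matrix.inv_pow', Matrix.mul_nonsing_inv]
    rw [Matrix.det_pow]
    exact hMu.pow t
  have h1 : Pbar *ᵥ (P₁ᵀ *ᵥ (state A η t).ofLp)
      = Matrix.diagonal (fun i => lam i ^ t) *ᵥ (Pbar *ᵥ zCoord A P₁ η t) := by
    rw [zCoord, ← hM, Matrix.mulVec_mulVec _ (Matrix.diagonal _), ← hpow, Matrix.mulVec_mulVec,
      Matrix.mulVec_mulVec, ← Matrix.mul_assoc, Matrix.mul_assoc Pbar, hMM, Matrix.mul_one]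
  rw [h1, Matrix.mulVec_diagonal]

/-- One step of the trajectory in the eigencoordinates `P̄ P₁ᵀ x_t`. -/
lemma abs_unstable_step_le {n k m : ℕ} {A : Matrix (Fin n) (Fin n) ℝ}
    {P₁ : Matrix (Fin n) (Fin k) ℝ} {P₂ : Matrix (Fin n) (Fin m) ℝ} (h₁ : P₁ᵀ * P₁ = 1)
    (h₂ : P₂ᵀ * P₂ = 1) (hone : P₁ * P₁ᵀ + P₂ * P₂ᵀ = 1) {lam : Fin k → ℝ}
    {Pbar : Matrix (Fin k) (Fin k) ℝ} (h : IsJordanForm (block A P₁) lam Pbar)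
    {η : ℕ → EuclideanSpace ℝ (Fin n)} {C B : ℝ} (hη : ∀ t, ‖η t‖ ≤ C)
    (hB : ∀ t, euclNorm (P₂ᵀ *ᵥ (state A η t).ofLp) ≤ B) (i : Fin k) (t : ℕ) :
    |(Pbar *ᵥ (P₁ᵀ *ᵥ (state A η (t + 1)).ofLp)) i
      - lam i * (Pbar *ᵥ (P₁ᵀ *ᵥ (state A η t).ofLp)) i| ≤ ‖A‖ * B + C := by
  set x := (state A η t).ofLp with hx
  set u := P₁ᵀ *ᵥ (A *ᵥ (P₂ *ᵥ (P₂ᵀ *ᵥ x)) + (η t).ofLp) with hu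
  have h3 : P₁ᵀ *ᵥ (state A η (t + 1)).ofLp = block A P₁ *ᵥ (P₁ᵀ *ᵥ x) + u := by
    have h4 : x = P₁ *ᵥ (P₁ᵀ *ᵥ x) + P₂ *ᵥ (P₂ᵀ *ᵥ x) := by
      rw [Matrix.mulVec_mulVec, Matrix.mulVec_mulVec, ← Matrix.add_mulVec, hone, Matrix.one_mulVec]
    rw [state_succ, ← hx]
    nth_rw 1 [h4]
    rw [hu, Matrix.mulVec_add A, add_assoc, Matrix.mulVec_add]
    congr 1
    simp only [block, Matrix.mulVec_mulVec, Matrix.mul_assoc]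
  have h5 : (Pbar *ᵥ (P₁ᵀ *ᵥ (state A η (t + 1)).ofLp)) i - lam i * (Pbar *ᵥ (P₁ᵀ *ᵥ x)) i
      = (Pbar *ᵥ u) i := by
    rw [h3, Matrix.mulVec_add, Matrix.mulVec_mulVec _ Pbar, h.mul_eq, ← Matrix.mulVec_mulVec _
      (Matrix.diagonal lam), Pi.add_apply, Matrix.mulVec_diagonal]
    ring
  rw [h5]
  refine (h.abs_mulVec_le u i).trans ((euclNorm_transpose_mulVec_le h₁ _).trans ?_)
  refine (euclNorm_add_le _ _).trans (add_le_add ?_ (hη t))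
  refine (euclNorm_mulVec_le _ _).trans ?_
  rw [euclNorm_isometry_mulVec h₂]
  exact mul_le_mul_of_nonneg_left (hB t) (norm_nonneg _)

/-- If the columns of `P̄ F` are, up to entrywise errors `b`, those of a Vandermonde matrix whose
rows are scaled by numbers of size at least `r`, then `Fᵀ` expands norms. -/
lemma euclNorm_transpose_mulVec_ge {k : ℕ} {M Pbar F : Matrix (Fin k) (Fin k) ℝ} {lam : Fin k → ℝ}
    (h : IsJordanForm M lam Pbar) (hlam : ∀ i, 1 ≤ |lam i|)
    (hdet : (Matrix.vandermonde fun i => (lam i)⁻¹).det ≠ 0) {w : Fin k → ℝ} {r b κ : ℝ}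
    (hr : 0 < r) (hw : ∀ i, r ≤ |w i|) (hb : 0 ≤ b)
    (hκ : κ = k * k.factorial / |(Matrix.vandermonde fun i => (lam i)⁻¹).det|)
    (hF : ∀ i j, |(Pbar * F) i j - (lam i)⁻¹ ^ (j : ℕ) * w i| ≤ b)
    (hpos : 0 ≤ r / κ - k * b) (a : Fin k → ℝ) :
    (r / κ - k * b) / k * euclNorm a ≤ euclNorm (Fᵀ *ᵥ a) := by
  rcases Nat.eq_zero_or_pos k with rfl | hk
  · simp [euclNorm_nonneg]
  have hk' : (0 : ℝ) < k := by exact_mod_cast hk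
  set V := Matrix.vandermonde fun i => (lam i)⁻¹ with hV
  have hκ0 : 0 < κ := by
    rw [hκ]
    have := abs_pos.2 hdet
    have := Nat.factorial_pos k
    positivity
  have hVe : ∀ i j, |V i j| ≤ 1 := fun i j => by
    rw [hV, Matrix.vandermonde_apply, abs_pow, abs_inv]
    exact pow_le_one₀ (by positivity) (inv_le_one_of_one_le₀ (hlam i))
  have hVinv : ‖V⁻¹ᵀ‖ ≤ κ := by
    rw [opNorm_transpose, hκ, mul_div_assoc]
    exact opNorm_le_of_abs_entry_le _ (by positivity) (abs_inv_apply_le hVe)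
  have hw0 : ∀ i, 0 < |w i| := fun i => hr.trans_le (hw i)
  set E := Pbar * F - Matrix.diagonal w * V with hE
  have hEn : ‖Eᵀ‖ ≤ k * b := by
    rw [opNorm_transpose]
    refine opNorm_le_of_abs_entry_le _ hb fun i j => ?_
    rw [hE, Matrix.sub_apply, Matrix.diagonal_mul, hV, Matrix.vandermonde_apply, mul_comm (w i)]
    exact hF i j
  have hG : ∀ c : Fin k → ℝ, (r / κ - k * b) * euclNorm c ≤ euclNorm ((Pbar * F)ᵀ *ᵥ c) := by
    intro c
    have h1 : (Pbar * F)ᵀ *ᵥ c = Vᵀ *ᵥ (Matrix.diagonal w *ᵥ c) + Eᵀ *ᵥ c := by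
      have : Pbar * F = Matrix.diagonal w * V + E := by rw [hE]; abel
      rw [this, Matrix.transpose_add, Matrix.add_mulVec, Matrix.transpose_mul,
        Matrix.diagonal_transpose, Matrix.mulVec_mulVec]
    have h2 : r * euclNorm c ≤ euclNorm (Matrix.diagonal w *ᵥ c) := by
      have h3 : Matrix.diagonal w⁻¹ * Matrix.diagonal w = 1 := by
        rw [Matrix.diagonal_mul_diagonal, ← Matrix.diagonal_one]
        congr 1
        ext i
        simp [abs_pos.1 (hw0 i)]
      have h4 : ‖Matrix.diagonal w⁻¹‖ ≤ 1 / r := by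
        rw [Matrix.l2_opNorm_diagonal, pi_norm_le_iff_of_nonneg (by positivity)]
        intro i
        rw [Pi.inv_apply, norm_inv, Real.norm_eq_abs, one_div]
        exact inv_anti₀ hr (hw i)
      have h5 := euclNorm_ge_of_inverse h3 h4 c
      rw [one_div, ← div_eq_inv_mul, le_div_iff₀ hr] at h5
      linarith
    have h6 : Vᵀ⁻¹ * Vᵀ = 1 :=
      Matrix.nonsing_inv_mul _ (by rw [Matrix.det_transpose]; exact isUnit_iff_ne_zero.2 hdet)
    rw [← Matrix.transpose_nonsing_inv] at h6
    have h7 := euclNorm_ge_of_inverse h6 hVinv (Matrix.diagonal w *ᵥ c)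
    have h8 : euclNorm (Eᵀ *ᵥ c) ≤ k * b * euclNorm c :=
      (euclNorm_mulVec_le _ _).trans (mul_le_mul_of_nonneg_right hEn (euclNorm_nonneg _))
    have h9 := euclNorm_sub_le_add (Vᵀ *ᵥ (Matrix.diagonal w *ᵥ c)) (Eᵀ *ᵥ c)
    rw [← h1] at h9
    have h10 : r / κ * euclNorm c ≤ euclNorm (Vᵀ *ᵥ (Matrix.diagonal w *ᵥ c)) := by
      rw [div_mul_eq_mul_div, div_le_iff₀ hκ0, mul_comm _ κ]
      exact h2.trans h7
    linarith
  have hPu : IsUnit (Pbarᵀ).det := by rw [Matrix.det_transpose]; exact h.isUnit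
  set c := Pbarᵀ⁻¹ *ᵥ a with hc
  have hac : Pbarᵀ *ᵥ c = a := by
    rw [hc, Matrix.mulVec_mulVec, Matrix.mul_nonsing_inv _ hPu, Matrix.one_mulVec]
  have h11 : Fᵀ *ᵥ a = (Pbar * F)ᵀ *ᵥ c := by
    rw [Matrix.transpose_mul, ← Matrix.mulVec_mulVec, hac]
  have h12 : euclNorm a ≤ k * euclNorm c := by
    rw [← hac]
    refine (euclNorm_mulVec_le _ _).trans (mul_le_mul_of_nonneg_right ?_ (euclNorm_nonneg _))
    rw [opNorm_transpose]
    exact h.norm_le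
  rw [h11]
  refine le_trans ?_ (hG c)
  rw [div_mul_eq_mul_div, div_le_iff₀ hk', mul_assoc, mul_comm _ (k : ℝ)]
  exact mul_le_mul_of_nonneg_left h12 hpos

/-- Dropping all but the last `k` columns of the data matrix. -/
lemma euclNorm_lastColumns_le {n k T : ℕ} (hkT : k ≤ T) (P : Matrix (Fin n) (Fin k) ℝ)
    (x : ℕ → EuclideanSpace ℝ (Fin n)) (a : Fin k → ℝ) :
    euclNorm ((Matrix.of fun i (j : Fin k) => (Pᵀ *ᵥ (x (T - j)).ofLp) i)ᵀ *ᵥ a)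
      ≤ euclNorm ((Pᵀ * dataMatrix x T)ᵀ *ᵥ a) := by
  refine le_of_sq_le_sq ?_ (euclNorm_nonneg _)
  rw [euclNorm_sq, euclNorm_sq]
  let φ : Fin k ↪ Fin T :=
    ⟨fun j => ⟨T - 1 - j, by omega⟩, fun i j hij => by
      have := congrArg Fin.val hij
      simp only at this
      exact Fin.ext (by omega)⟩
  have h1 : ∀ j : Fin k,
      ((Matrix.of fun i (j : Fin k) => (Pᵀ *ᵥ (x (T - j)).ofLp) i)ᵀ *ᵥ a) j
        = ((Pᵀ * dataMatrix x T)ᵀ *ᵥ a) (φ j) := by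
    intro j
    have h2 : T - (j : ℕ) = T - 1 - j + 1 := by omega
    have h3 : ∀ i, (Pᵀ *ᵥ (x (T - j)).ofLp) i = (Pᵀ * dataMatrix x T) i (φ j) := fun i => by
      rw [h2]; rfl
    simp only [Matrix.mulVec, dotProduct, Matrix.transpose_apply, Matrix.of_apply]
    exact Finset.sum_congr rfl fun i _ => by rw [← h3 i]; rfl
  calc ∑ j, ((Matrix.of fun i (j : Fin k) => (Pᵀ *ᵥ (x (T - j)).ofLp) i)ᵀ *ᵥ a) j ^ 2
      = ∑ j, ((Pᵀ * dataMatrix x T)ᵀ *ᵥ a) (φ j) ^ 2 := by simp only [h1]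
    _ = ∑ t ∈ Finset.univ.map φ, ((Pᵀ * dataMatrix x T)ᵀ *ᵥ a) t ^ 2 := by rw [Finset.sum_map]
    _ ≤ _ := Finset.sum_le_sum_of_subset_of_nonneg (Finset.subset_univ _)
        fun _ _ _ => sq_nonneg _

/-! ### The sample size -/

/-- The sample size makes `aᵀ` dominate all the other quantities. Hadamard's bound on the gap `g` is
what bounds `k`, `k log k` and `-log g` separately by the sum `1 + k log k - log g`. -/
lemma exists_sampleSize_const {a b B : ℝ} (ha : 1 < a) (hb : 1 ≤ b) (hB : 0 < B) :
    ∃ c : ℝ, 0 < c ∧ ∀ (k T : ℕ) (m δ g : ℝ), 0 < k → 0 ≤ m → 0 < δ → δ ≤ 1 → 0 < g →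
      g ≤ (k : ℝ) ^ k * a⁻¹ ^ (k * (k - 1)) →
      c * (1 + k * Real.log k + m + Real.log (1 / δ) - Real.log g) ≤ T →
      k ≤ T ∧ B * (k : ℝ) ^ 5 * (k.factorial : ℝ) ^ 2 * b ^ k * T ≤ a ^ T * δ * g := by
  set l := Real.log a with hl
  have hl0 : 0 < l := Real.log_pos ha
  have hlb : 0 ≤ Real.log b := Real.log_nonneg hb
  set c₁ := |Real.log B| + |Real.log (2 / l)| + 7 / l + Real.log b * (1 + 1 / l) + 2 with hc₁
  have hc₁0 : 0 < c₁ := by positivity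
  refine ⟨2 / l * c₁ + (1 + 1 / l), by positivity, ?_⟩
  intro k T m δ g hk hm hδ hδ1 hg hgle hT
  have hk1 : (1 : ℝ) ≤ k := by exact_mod_cast hk
  have hk0 : (0 : ℝ) < k := by linarith
  have hlogk : 0 ≤ Real.log k := Real.log_nonneg hk1
  set X := k * Real.log k - Real.log g with hX
  set d := Real.log (1 / δ) with hd
  have hd0 : 0 ≤ d := Real.log_nonneg (by rw [le_div_iff₀ hδ]; linarith)
  have hdδ : Real.log δ = -d := by rw [hd, one_div, Real.log_inv]; ring
  have hkk : ((k * (k - 1) : ℕ) : ℝ) = k * (k - 1) := by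
    rw [Nat.cast_mul, Nat.cast_sub hk, Nat.cast_one]
  have hXl : k * (k - 1) * l ≤ X := by
    have h1 := Real.log_le_log hg hgle
    rw [Real.log_mul (by positivity) (by positivity), Real.log_pow, Real.log_pow, Real.log_inv,
      hkk] at h1
    rw [hX]
    linarith
  have hkk0 : (0 : ℝ) ≤ k * (k - 1) := mul_nonneg hk0.le (by linarith)
  have hkX : (k : ℝ) * (k - 1) ≤ X / l := by rwa [le_div_iff₀ hl0]
  have hX0 : 0 ≤ X := (mul_nonneg hkk0 hl0.le).trans hXl
  have hXl0 : 0 ≤ X / l := by positivity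
  have hklog : k * Real.log k ≤ X / l := by
    refine le_trans ?_ hkX
    exact mul_le_mul_of_nonneg_left (Real.log_le_sub_one_of_pos hk0) hk0.le
  have hlogkX : Real.log k ≤ X / l := (le_mul_of_one_le_left hlogk hk1).trans hklog
  have hkle : (k : ℝ) ≤ 1 + X / l := by
    have : (k : ℝ) - 1 ≤ k * (k - 1) := le_mul_of_one_le_left (by linarith) hk1
    linarith
  set Y := 1 + X + m + d with hY
  have hTY : (2 / l * c₁ + (1 + 1 / l)) * Y ≤ T := by
    refine le_trans (le_of_eq ?_) hT
    rw [hY, hX]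
    ring
  have hY1 : 1 ≤ Y := by rw [hY]; linarith
  have hXY : X ≤ Y := by rw [hY]; linarith
  have hdY : d ≤ Y := by rw [hY]; linarith
  have hXYl : X / l ≤ 1 / l * Y := by
    rw [div_mul_eq_mul_div, one_mul]
    gcongr
  have hkT : (k : ℝ) ≤ T := by
    have h1 : 0 ≤ 2 / l * c₁ * Y := by positivity
    have h2 : (2 / l * c₁ + (1 + 1 / l)) * Y = 2 / l * c₁ * Y + Y + 1 / l * Y := by ring
    linarith
  have hT1 : (1 : ℝ) ≤ T := hk1.trans hkT
  have hT0 : (0 : ℝ) < T := by linarith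
  refine ⟨by exact_mod_cast hkT, ?_⟩
  have hfac : Real.log (k.factorial : ℝ) ≤ X / l := by
    refine le_trans ?_ hklog
    rw [← Real.log_pow]
    exact Real.log_le_log (by exact_mod_cast Nat.factorial_pos k)
      (by exact_mod_cast Nat.factorial_le_pow k)
  have hfac0 : (0 : ℝ) < k.factorial := by exact_mod_cast Nat.factorial_pos k
  have hlogT : Real.log T ≤ T * l / 2 + Real.log (2 / l) := by
    have h1 : (T : ℝ) = (T * l / 2) * (2 / l) := by field_simp
    have h2 : Real.log T = Real.log (T * l / 2) + Real.log (2 / l) := by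
      rw [← Real.log_mul (by positivity) (by positivity), ← h1]
    have h3 := Real.log_le_sub_one_of_pos (show 0 < T * l / 2 by positivity)
    linarith
  have hcT : c₁ * Y ≤ T * l / 2 := by
    have h1 : 2 / l * c₁ * Y ≤ T := by
      have h3 : 0 ≤ (1 + 1 / l) * Y := by positivity
      have h4 : (2 / l * c₁ + (1 + 1 / l)) * Y = 2 / l * c₁ * Y + (1 + 1 / l) * Y := by ring
      linarith
    have h2 : 2 / l * c₁ * Y = (c₁ * Y) * 2 / l := by ring
    rw [h2, div_le_iff₀ hl0] at h1
    linarith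
  have hb1 : k * Real.log b ≤ Real.log b * (1 + 1 / l) * Y := by
    have h1 : (k : ℝ) ≤ (1 + 1 / l) * Y := by
      have h2 : (1 + 1 / l) * Y = Y + 1 / l * Y := by ring
      linarith
    have h3 := mul_le_mul_of_nonneg_right h1 hlb
    linarith
  have hB1 : Real.log B ≤ |Real.log B| * Y :=
    (le_abs_self _).trans (le_mul_of_one_le_right (abs_nonneg _) hY1)
  have hl1 : Real.log (2 / l) ≤ |Real.log (2 / l)| * Y :=
    (le_abs_self _).trans (le_mul_of_one_le_right (abs_nonneg _) hY1)
  have h7 : 7 * (X / l) ≤ 7 / l * Y := by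
    have : 7 / l * Y = 7 * (1 / l * Y) := by ring
    linarith
  have hfb : (0 : ℝ) < b := by linarith
  have hfa : (0 : ℝ) < a := by linarith
  rw [← Real.log_le_log_iff (by positivity) (by positivity)]
  rw [Real.log_mul (by positivity) (by positivity), Real.log_mul (by positivity) (by positivity),
    Real.log_mul (by positivity) (by positivity), Real.log_mul (by positivity) (by positivity),
    Real.log_mul (by positivity) (by positivity), Real.log_mul (by positivity) (by positivity),
    Real.log_pow, Real.log_pow, Real.log_pow, Real.log_pow, hdδ, ← hl]
  push_cast
  have hgX : Real.log g = k * Real.log k - X := by rw [hX]; ring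
  have hklog0 : 0 ≤ k * Real.log k := by positivity
  have hc₁Y : c₁ * Y = |Real.log B| * Y + |Real.log (2 / l)| * Y + 7 / l * Y
      + Real.log b * (1 + 1 / l) * Y + 2 * Y := by rw [hc₁]; ring
  rw [hgX]
  linarith

/-! ### Anti-concentration -/

lemma measure_abs_lt_le {Ω : Type*} [MeasurableSpace Ω] {μ : Measure Ω} {X : Ω → ℝ} {M r : ℝ}
    [HasPDF X μ volume] (hM : essSup (pdf X μ volume) volume < ENNReal.ofReal M) :
    μ {ω | |X ω| < r} ≤ ENNReal.ofReal M * ENNReal.ofReal (2 * r) := by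
  have h1 : {ω | |X ω| < r} = X ⁻¹' Set.Ioo (-r) r := by
    ext ω
    simp [abs_lt]
  rw [h1]
  calc μ (X ⁻¹' Set.Ioo (-r) r) ≤ Measure.map X μ (Set.Ioo (-r) r) :=
        Measure.le_map_apply (HasPDF.aemeasurable X μ volume) _
    _ = ∫⁻ x in Set.Ioo (-r) r, pdf X μ volume x :=
        map_eq_setLIntegral_pdf X μ volume measurableSet_Ioo
    _ ≤ ∫⁻ _x in Set.Ioo (-r) r, ENNReal.ofReal M := by
        refine lintegral_mono_ae ?_
        filter_upwards [ae_restrict_of_ae (ENNReal.ae_le_essSup (pdf X μ volume))] with x hx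
        exact hx.trans hM.le
    _ = _ := by
        rw [setLIntegral_const, Real.volume_Ioo]
        congr 2
        ring

lemma PdfAssumption.pos {Ω : Type*} [MeasurableSpace Ω] {μ : Measure Ω} {n k : ℕ} (hk : 0 < k)
    {A : Matrix (Fin n) (Fin n) ℝ} {P₁ : Matrix (Fin n) (Fin k) ℝ} {Pbar : Matrix (Fin k) (Fin k) ℝ}
    {η : ℕ → Ω → EuclideanSpace ℝ (Fin n)} {Cz : ℝ} (h : PdfAssumption μ A P₁ Pbar η Cz) :
    0 < Cz :=
  ENNReal.ofReal_pos.1 (bot_le.trans_lt (h 1 le_rfl ⟨0, hk⟩).2)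

/-- With probability at least `1 - 4 θ` the noise is bounded by `C` and all coordinates `P̄ z_T` are
bounded away from zero. -/
lemma exists_good_event {Ω : Type*} [MeasurableSpace Ω] {μ : Measure Ω} [IsProbabilityMeasure μ]
    {n k : ℕ} (hk : 0 < k) {A : Matrix (Fin n) (Fin n) ℝ} {P₁ : Matrix (Fin n) (Fin k) ℝ}
    {Pbar : Matrix (Fin k) (Fin k) ℝ} {η : ℕ → Ω → EuclideanSpace ℝ (Fin n)} {C Cz θ : ℝ}
    (hθ : 0 < θ) (hη : NoiseAssumption μ η C) (hpdf : PdfAssumption μ A P₁ Pbar η Cz) {T : ℕ}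
    (hT : 1 ≤ T) :
    ∃ S : Set Ω, MeasurableSet S ∧ ENNReal.ofReal (1 - 4 * θ) ≤ μ S ∧ ∀ ω ∈ S,
      (∀ t, ‖η t ω‖ ≤ C) ∧
      ∀ i, θ / (k * Cz) ≤ |(Pbar *ᵥ zCoord A P₁ (fun s => η s ω) T) i| := by
  have hCz := hpdf.pos hk
  have hk' : (0 : ℝ) < k := by exact_mod_cast hk
  set r := θ / (k * Cz) with hr
  set Z : Ω → Fin k → ℝ := fun ω => Pbar *ᵥ zCoord A P₁ (fun s => η s ω) T with hZ
  set bad : Set Ω := {ω | ¬ ∀ t, ‖η t ω‖ < C} ∪ ⋃ i, {ω | |Z ω i| < r} with hbad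
  have hbad_le : μ bad ≤ ENNReal.ofReal (2 * θ) := by
    refine (measure_union_le _ _).trans ?_
    have h1 : μ {ω | ¬ ∀ t, ‖η t ω‖ < C} = 0 := ae_iff.1 (ae_all_iff.2 hη.bounded)
    rw [h1, zero_add]
    refine (measure_iUnion_fintype_le _ _).trans ?_
    calc ∑ i, μ {ω | |Z ω i| < r}
        ≤ ∑ _i : Fin k, ENNReal.ofReal Cz * ENNReal.ofReal (2 * r) := by
          refine Finset.sum_le_sum fun i _ => ?_
          have h2 := hpdf T hT i
          have := h2.1
          have h3 := measure_abs_lt_le (r := r) h2.2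
          simpa only [abs_abs] using h3
      _ = ENNReal.ofReal (2 * θ) := by
          rw [Finset.sum_const, Finset.card_univ, Fintype.card_fin, nsmul_eq_mul,
            ← ENNReal.ofReal_mul hCz.le, ← ENNReal.ofReal_natCast, ← ENNReal.ofReal_mul hk'.le]
          congr 1
          rw [hr]
          field_simp
  refine ⟨(toMeasurable μ bad)ᶜ, (measurableSet_toMeasurable μ bad).compl, ?_, ?_⟩
  · rw [prob_compl_eq_one_sub (measurableSet_toMeasurable μ bad), measure_toMeasurable]
    calc ENNReal.ofReal (1 - 4 * θ) ≤ ENNReal.ofReal (1 - 2 * θ) :=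
          ENNReal.ofReal_le_ofReal (by linarith)
      _ = 1 - ENNReal.ofReal (2 * θ) := by
          rw [ENNReal.ofReal_sub _ (by linarith), ENNReal.ofReal_one]
      _ ≤ 1 - μ bad := by gcongr
  · intro ω hω
    have hω' : ω ∉ bad := fun h => hω (subset_toMeasurable μ bad h)
    rw [hbad, Set.mem_union, not_or, Set.mem_iUnion, not_exists] at hω'
    refine ⟨fun t => (not_not.1 hω'.1 t).le, fun i => not_lt.1 (hω'.2 i)⟩

/-! ### Accuracy of the estimators along one trajectory -/

lemma norm_block_sub_le {n k : ℕ} (A : Matrix (Fin n) (Fin n) ℝ) {P Q : Matrix (Fin n) (Fin k) ℝ}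
    (hP : Pᵀ * P = 1) (hQ : Qᵀ * Q = 1) : ‖block A P - block A Q‖ ≤ 2 * ‖A‖ * ‖P - Q‖ := by
  have h1 : block A P - block A Q = Pᵀ * (A * (P - Q)) + (P - Q)ᵀ * (A * Q) := by
    simp only [block, Matrix.transpose_sub, Matrix.mul_sub, Matrix.sub_mul, Matrix.mul_assoc]
    abel
  have hP1 : ‖Pᵀ‖ ≤ 1 := by rw [opNorm_transpose]; exact opNorm_isometry_le hP
  have hQ1 := opNorm_isometry_le hQ
  calc ‖block A P - block A Q‖
      ≤ ‖Pᵀ * (A * (P - Q))‖ + ‖(P - Q)ᵀ * (A * Q)‖ := by rw [h1]; exact norm_add_le _ _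
    _ ≤ ‖Pᵀ‖ * (‖A‖ * ‖P - Q‖) + ‖(P - Q)ᵀ‖ * (‖A‖ * ‖Q‖) := by
        gcongr
        · refine (Matrix.l2_opNorm_mul _ _).trans ?_
          gcongr
          exact Matrix.l2_opNorm_mul _ _
        · refine (Matrix.l2_opNorm_mul _ _).trans ?_
          gcongr
          exact Matrix.l2_opNorm_mul _ _
    _ ≤ 1 * (‖A‖ * ‖P - Q‖) + ‖P - Q‖ * (‖A‖ * 1) := by
        rw [opNorm_transpose (P - Q)]
        gcongr
    _ = _ := by ring

lemma IsJordanForm.abs_le_norm {k : ℕ} {M Pbar : Matrix (Fin k) (Fin k) ℝ} {lam : Fin k → ℝ}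
    (h : IsJordanForm M lam Pbar) (i : Fin k) : |lam i| ≤ ‖M‖ := by
  have h1 : Mᵀ *ᵥ Pbar i = lam i • Pbar i := by
    ext j
    have h2 := congrFun (congrFun h.mul_eq i) j
    rw [Matrix.diagonal_mul, Matrix.mul_apply] at h2
    rw [Pi.smul_apply, smul_eq_mul, ← h2]
    simp only [Matrix.mulVec, dotProduct, Matrix.transpose_apply]
    exact Finset.sum_congr rfl fun l _ => mul_comm _ _
  have h3 : euclNorm (Pbar i) = 1 := by
    have := euclNorm_sq (Pbar i)
    rw [h.unit_row i] at this
    exact (pow_eq_one_iff_of_nonneg (euclNorm_nonneg _) two_ne_zero).1 this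
  have h4 := euclNorm_mulVec_le Mᵀ (Pbar i)
  have h5 : euclNorm (lam i • Pbar i) = |lam i| * euclNorm (Pbar i) :=
    norm_smul (lam i) (WithLp.toLp 2 (Pbar i))
  rwa [h1, h5, h3, mul_one, mul_one, opNorm_transpose] at h4

/-- `Dᵀ` expands the norms of vectors in `E_u` by an amount of order `aᵀ`. -/
lemma euclNorm_dataMatrix_ge {n k m T : ℕ} (hkT : k ≤ T) {A : Matrix (Fin n) (Fin n) ℝ}
    {P₁ : Matrix (Fin n) (Fin k) ℝ} {P₂ : Matrix (Fin n) (Fin m) ℝ} (h₁ : P₁ᵀ * P₁ = 1)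
    (h₂ : P₂ᵀ * P₂ = 1) (hone : P₁ * P₁ᵀ + P₂ * P₂ᵀ = 1) {lam : Fin k → ℝ}
    {Pbar : Matrix (Fin k) (Fin k) ℝ} (hJ : IsJordanForm (block A P₁) lam Pbar)
    {a : ℝ} (ha : 1 < a) (hlam : ∀ i, a ≤ |lam i|)
    (hdet : (Matrix.vandermonde fun i => (lam i)⁻¹).det ≠ 0)
    {η : ℕ → EuclideanSpace ℝ (Fin n)} {C B b r κ : ℝ} (hη : ∀ t, ‖η t‖ ≤ C)
    (hB : ∀ t, euclNorm (P₂ᵀ *ᵥ (state A η t).ofLp) ≤ B)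
    (hb : (‖A‖ * B + C) / (a - 1) ≤ b) (hr : 0 < r)
    (hz : ∀ i, r ≤ |(Pbar *ᵥ zCoord A P₁ η T) i|)
    (hκ : κ = k * k.factorial / |(Matrix.vandermonde fun i => (lam i)⁻¹).det|)
    (hpos : 0 ≤ a ^ T * r / κ - k * b) (y : Fin k → ℝ) :
    (a ^ T * r / κ - k * b) / k * euclNorm y
      ≤ euclNorm ((P₁ᵀ * dataMatrix (state A η) T)ᵀ *ᵥ y) := by
  have ha0 : 0 < a := by linarith
  have hB0 : 0 ≤ B := (euclNorm_nonneg _).trans (hB 0)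
  have hC0 : 0 ≤ C := (norm_nonneg _).trans (hη 0)
  have hb0 : 0 ≤ b := le_trans (div_nonneg (by positivity) (by linarith)) hb
  have hlam0 : ∀ i, lam i ≠ 0 := fun i h => by
    have := hlam i
    rw [h, abs_zero] at this
    linarith
  set v : ℕ → Fin k → ℝ := fun t => Pbar *ᵥ (P₁ᵀ *ᵥ (state A η t).ofLp) with hv
  refine (euclNorm_transpose_mulVec_ge (w := v T) hJ (fun i => ha.le.trans (hlam i)) hdet
    (by positivity) ?_ hb0 hκ ?_ hpos y).trans (euclNorm_lastColumns_le hkT P₁ (state A η) y)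
  · intro i
    have h1 : v T i = lam i ^ T * (Pbar *ᵥ zCoord A P₁ η T) i := mulVec_zCoord hJ hlam0 η T i
    rw [h1, abs_mul, abs_pow]
    exact mul_le_mul (pow_le_pow_left₀ ha0.le (hlam i) T) (hz i) hr.le (by positivity)
  · intro i j
    have h1 := abs_sub_inv_pow_mul_le (v := fun t => v t i) ha (hlam i)
      (fun t => abs_unstable_step_le h₁ h₂ hone hJ hη hB i t) (T - j) j
    have h2 : T - (j : ℕ) + j = T := by omega
    rw [h2] at h1
    exact h1.trans hb

/-- The conclusions of the theorem follow once `Dᵀ` expands norms on `E_u` by a factor `L` that is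
large compared with the stable coordinates and the noise.

For the powers, the estimate is compared with `M⋆ = Qsᵀ A Qs`, where `Qs` is the basis of `E_u`
closest to `Ph`. The difference between the estimate and `M⋆` is so small compared with the constant
`K` in `‖M⋆ᵗ‖ ≤ K aᵗ` that the powers of the estimate still grow at most at the rate `a + ε`. Both
`M⋆` and `Q₁ᵀ A Q₁` inherit the Gelfand constant of `A`. -/
lemma estimator_accuracy {n k m T : ℕ} (hk : 0 < k) (hkn : k < n) (hkT : k ≤ T)
    {A : Matrix (Fin n) (Fin n) ℝ} {lam : Fin n → ℝ}
    {P₁ : Matrix (Fin n) (Fin k) ℝ} {P₂ : Matrix (Fin n) (Fin m) ℝ}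
    (h₁ : IsOrthonormalBasisOf P₁ (unstableSubspace A lam k))
    (h₂ : P₂ᵀ * P₂ = 1) (hone : P₁ * P₁ᵀ + P₂ * P₂ᵀ = 1)
    {η : ℕ → EuclideanSpace ℝ (Fin n)} {C B L K a ε ζ δ : ℝ} (hη : ∀ t, ‖η t‖ ≤ C)
    (hB : ∀ t, euclNorm (P₂ᵀ *ᵥ (state A η t).ofLp) ≤ B) (hL : 0 < L)
    (hDL : ∀ y, L * euclNorm y ≤ euclNorm ((P₁ᵀ * dataMatrix (state A η) T)ᵀ *ᵥ y))
    (ha : 0 ≤ a) (hK0 : 0 ≤ K) (hK : ∀ t : ℕ, ‖block A P₁ ^ t‖ ≤ K * a ^ t) (hζ1 : 1 ≤ ζ)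
    (hζ : ∀ t : ℕ, ‖A ^ t‖ ≤ ζ * (a + ε) ^ t) (hA1 : 1 ≤ ‖A‖) (hε : 0 < ε)
    (hδ : 0 < δ) (hδ1 : δ ≤ 1) (hc₁ : 8 * (T * B) ≤ L * δ)
    (hc₂ : K * (T * (4 * ‖A‖ * B + C)) ≤ L * (δ / 2))
    (hc₃ : K * (T * (4 * ‖A‖ * B + C)) ≤ L * ε)
    {U : Matrix (Fin n) (Fin n) ℝ} {σ : ℕ → ℝ} {V : Matrix (Fin T) (Fin T) ℝ}
    (hSVD : IsSVD (dataMatrix (state A η) T) U σ V) :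
    ∃ Mhat : Matrix (Fin k) (Fin k) ℝ,
      (∀ M, IsLeastSquares (state A η) T (topColumns hkn.le U) M ↔ M = Mhat) ∧
      (∃ Q₁, IsOrthonormalBasisOf Q₁ (unstableSubspace A lam k) ∧
        ‖Q₁ - topColumns hkn.le U‖ < δ) ∧
      ∀ Q₁, IsOrthonormalBasisOf Q₁ (unstableSubspace A lam k) →
        ‖Q₁ - topColumns hkn.le U‖ < δ → ∀ τ : ℕ,
          ‖Mhat ^ τ - block A Q₁ ^ τ‖ ≤ 3 * τ * ‖A‖ * ζ ^ 2 * (a + ε) ^ (τ - 1) * δ := by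
  have hB0 : 0 ≤ B := (euclNorm_nonneg _).trans (hB 0)
  have hC0 : 0 ≤ C := (norm_nonneg _).trans (hη 0)
  have hσ : ∀ j < k, L ≤ σ j := fun j hj =>
    (hSVD.le_singularValue hk h₁.1 hDL).trans (hSVD.antitone (by omega))
  obtain ⟨R, S, hDR, hRS, hR⟩ := hSVD.exists_right_factor hkn.le hkT hL hσ
  have hPh := hSVD.transpose_mul_topColumns hkn.le (k := k)
  set Ph := topColumns hkn.le U with hPhdef
  set D := dataMatrix (state A η) T with hD
  set N : Matrix (Fin n) (Fin T) ℝ := Matrix.of fun i t => η (t + 1) i with hN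
  -- The frame is close to `E_u`.
  have hS : ‖P₂ᵀ * Ph‖ ≤ T * B / L := by
    have h3 : ‖P₂ᵀ * D‖ ≤ T * B :=
      opNorm_le_of_euclNorm_col_le _ hB0 fun t => hB (t + 1)
    rw [← hDR, ← Matrix.mul_assoc]
    calc ‖P₂ᵀ * D * R‖ ≤ ‖P₂ᵀ * D‖ * ‖R‖ := Matrix.l2_opNorm_mul _ _
      _ ≤ (T * B) * (1 / L) := by gcongr
      _ = T * B / L := by ring
  have hTB : T * B / L ≤ δ / 8 := by
    rw [div_le_iff₀ hL]
    linarith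
  obtain ⟨W, hW, hQs⟩ := exists_rotation_close h₁.1 h₂ hone hPh (by linarith)
  set Qs := P₁ * W with hQsdef
  have hQsE : IsOrthonormalBasisOf Qs (unstableSubspace A lam k) := h₁.mul_rotation hW
  have hQsδ : ‖Qs - Ph‖ ≤ δ / 4 := by linarith
  -- The estimate is a compression of `A` plus a term linear in the noise.
  set Mhat := Phᵀ * dataMatrix (fun t => state A η (t + 1)) T * R with hMhat
  have hshift : dataMatrix (fun t => state A η (t + 1)) T = A * D + N := by
    ext i t
    exact congrFun (state_succ A η (t + 1)) i
  have hMhat' : Mhat = block A Ph + Phᵀ * (N * R) := by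
    rw [hMhat, hshift, Matrix.mul_add, Matrix.add_mul, Matrix.mul_assoc, Matrix.mul_assoc A, hDR,
      block, Matrix.mul_assoc, Matrix.mul_assoc]
  have hnoise : ‖Phᵀ * (N * R)‖ ≤ T * C / L := by
    have h3 : ‖N‖ ≤ T * C := opNorm_le_of_euclNorm_col_le _ hC0 fun t => hη (t + 1)
    have h4 : ‖Phᵀ‖ ≤ 1 := by rw [opNorm_transpose]; exact opNorm_isometry_le hPh
    calc ‖Phᵀ * (N * R)‖ ≤ ‖Phᵀ‖ * (‖N‖ * ‖R‖) :=
          (Matrix.l2_opNorm_mul _ _).trans (by gcongr; exact Matrix.l2_opNorm_mul _ _)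
      _ ≤ 1 * ((T * C) * (1 / L)) := by gcongr
      _ = T * C / L := by ring
  have hE : ‖Mhat - block A Qs‖ ≤ T * (4 * ‖A‖ * B + C) / L := by
    have h3 : Mhat - block A Qs = Phᵀ * (N * R) - (block A Qs - block A Ph) := by
      rw [hMhat']; abel
    have h4 := norm_block_sub_le A hQsE.1 hPh
    calc ‖Mhat - block A Qs‖ ≤ ‖Phᵀ * (N * R)‖ + ‖block A Qs - block A Ph‖ := by
          rw [h3]; exact norm_sub_le _ _
      _ ≤ T * C / L + 2 * ‖A‖ * (2 * (T * B / L)) := by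
          refine add_le_add hnoise (h4.trans ?_)
          gcongr
          linarith
      _ = _ := by ring
  have hKE : K * ‖Mhat - block A Qs‖ ≤ δ / 2 ∧ K * ‖Mhat - block A Qs‖ ≤ ε := by
    have h3 : K * ‖Mhat - block A Qs‖ ≤ K * (T * (4 * ‖A‖ * B + C)) / L := by
      rw [mul_div_assoc]
      gcongr
    exact ⟨h3.trans (by rw [div_le_iff₀ hL]; linarith), h3.trans (by rw [div_le_iff₀ hL]; linarith)⟩
  have hQpow : ∀ Q, IsOrthonormalBasisOf Q (unstableSubspace A lam k) → ∀ t : ℕ,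
      ‖block A Q ^ t‖ ≤ ζ * (a + ε) ^ t := fun Q hQ t => by
    rw [hQ.block_pow]
    exact (norm_conj_le hQ.1 _).trans (hζ t)
  have hQsK : ∀ t : ℕ, ‖block A Qs ^ t‖ ≤ K * a ^ t := fun t => by
    have h3 : Qsᵀ * A ^ t * Qs = Wᵀ * (block A P₁ ^ t) * W := by
      rw [h₁.block_pow, hQsdef, Matrix.transpose_mul]
      simp only [Matrix.mul_assoc]
    rw [hQsE.block_pow, h3]
    exact (norm_conj_le hW _).trans (hK t)
  have hMpow : ∀ t : ℕ, ‖Mhat ^ t‖ ≤ K * (a + ε) ^ t := fun t => by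
    refine (norm_pow_le_of_perturbation (Y := block A Qs) ha hK0 hQsK t).trans ?_
    gcongr
    exact hKE.2
  refine ⟨Mhat, isLeastSquares_iff _ rfl T hPh hDR hRS, ⟨Qs, hQsE, by linarith⟩, ?_⟩
  intro Q₁ hQ₁ hQ₁δ τ
  have h5 := norm_pow_sub_pow_le hMpow (hQpow Qs hQsE) τ
  have h6 := norm_pow_sub_pow_le (hQpow Qs hQsE) (hQpow Q₁ hQ₁) τ
  have h7 : ‖block A Qs - block A Q₁‖ ≤ 2 * ‖A‖ * (5 / 4 * δ) := by
    refine (norm_block_sub_le A hQsE.1 hQ₁.1).trans ?_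
    have h8 : Qs - Q₁ = (Qs - Ph) - (Q₁ - Ph) := by abel
    have h9 : ‖Qs - Q₁‖ ≤ 5 / 4 * δ := by
      rw [h8]
      refine (norm_sub_le _ _).trans ?_
      linarith
    gcongr
  have hζA : ζ ≤ ζ ^ 2 * ‖A‖ := by
    have : ζ * 1 ≤ ζ * (ζ * ‖A‖) := by
      gcongr
      exact one_le_mul_of_one_le_of_one_le hζ1 hA1
    linarith
  have hp : 0 ≤ (τ : ℝ) * (a + ε) ^ (τ - 1) := by positivity
  calc ‖Mhat ^ τ - block A Q₁ ^ τ‖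
      ≤ ‖Mhat ^ τ - block A Qs ^ τ‖ + ‖block A Qs ^ τ - block A Q₁ ^ τ‖ :=
        norm_sub_le_norm_sub_add_norm_sub _ _ _
    _ ≤ τ * (K * ζ) * (a + ε) ^ (τ - 1) * ‖Mhat - block A Qs‖
        + τ * (ζ * ζ) * (a + ε) ^ (τ - 1) * ‖block A Qs - block A Q₁‖ := add_le_add h5 h6
    _ = (τ * (a + ε) ^ (τ - 1)) * (ζ * (K * ‖Mhat - block A Qs‖)
        + ζ ^ 2 * ‖block A Qs - block A Q₁‖) := by ring
    _ ≤ (τ * (a + ε) ^ (τ - 1)) * ((ζ ^ 2 * ‖A‖) * (δ / 2)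
        + ζ ^ 2 * (2 * ‖A‖ * (5 / 4 * δ))) := by
        gcongr
        exact hKE.1
    _ = 3 * τ * ‖A‖ * ζ ^ 2 * (a + ε) ^ (τ - 1) * δ := by ring

/-! ### Choice of the constants -/

/-- With `κ = k · k! / |det V|` and `K = k κ ζ bᵏ`, the growth of `aᵀ` beyond the bound of
`exists_sampleSize_const` makes the expansion factor of `euclNorm_dataMatrix_ge` large. -/
lemma expansion_factor_ge {k T : ℕ} (hk : 0 < k) (hT : 0 < T) {a b ζ Cz θ B₄ B₆ δ d κ K L : ℝ}
    (hb : 1 ≤ b) (hζ : 1 ≤ ζ) (hCz : 0 < Cz) (hθ : 0 < θ) (hB₄ : 0 ≤ B₄) (hB₆ : 0 < B₆)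
    (hδ : 0 < δ) (hδ1 : δ ≤ 1) (hd : 0 < d) (hdk : d ≤ k.factorial)
    (hκ : κ = k * k.factorial / d) (hK : K = k * κ * ζ * b ^ k)
    (hL : L = (a ^ T * (θ / (k * Cz)) / κ - k * B₄) / k)
    (h : Cz * ζ * (B₆ + B₄) / θ * (k : ℝ) ^ 5 * (k.factorial : ℝ) ^ 2 * b ^ k * T
      ≤ a ^ T * δ * d ^ 2) :
    1 ≤ K ∧ 0 < L ∧ K * T * B₆ ≤ L * δ := by
  have hk1 : (1 : ℝ) ≤ k := by exact_mod_cast hk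
  have hk0 : (0 : ℝ) < k := by linarith
  have hT1 : (1 : ℝ) ≤ T := by exact_mod_cast hT
  have hfac : (0 : ℝ) < k.factorial := by exact_mod_cast Nat.factorial_pos k
  have hκ1 : 1 ≤ κ := by
    rw [hκ, le_div_iff₀ hd, one_mul]
    exact hdk.trans (le_mul_of_one_le_left hfac.le hk1)
  have hκ0 : 0 < κ := by linarith
  have hbk : 1 ≤ b ^ k := one_le_pow₀ hb
  have hK1 : 1 ≤ K := by
    rw [hK]
    exact one_le_mul_of_one_le_of_one_le (one_le_mul_of_one_le_of_one_le
      (one_le_mul_of_one_le_of_one_le hk1 hκ1) hζ) hbk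
  have h1 : k * (K * T * (B₆ + B₄)) ≤ a ^ T * (θ / (k * Cz)) / κ * δ := by
    have h2 : k * (K * T * (B₆ + B₄)) * (k * Cz * κ * d ^ 2 / θ)
        = Cz * ζ * (B₆ + B₄) / θ * (k : ℝ) ^ 5 * (k.factorial : ℝ) ^ 2 * b ^ k * T := by
      rw [hK, hκ]
      field_simp
    have h3 : a ^ T * (θ / (k * Cz)) / κ * δ * (k * Cz * κ * d ^ 2 / θ) = a ^ T * δ * d ^ 2 := by
      field_simp
    refine le_of_mul_le_mul_right ?_ (show 0 < k * Cz * κ * d ^ 2 / θ by positivity)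
    rw [h2, h3]
    exact h
  have hKT : 1 ≤ K * T := one_le_mul_of_one_le_of_one_le hK1 hT1
  have h4 : K * T * B₆ ≤ L * δ := by
    have h5 : L * δ = (a ^ T * (θ / (k * Cz)) / κ * δ - k * (δ * B₄)) / k := by rw [hL]; ring
    rw [h5, le_div_iff₀ hk0]
    have h6 : δ * B₄ ≤ K * T * B₄ := by
      gcongr
      linarith
    nlinarith
  refine ⟨hK1, ?_, h4⟩
  have h7 : 0 < L * δ := lt_of_lt_of_le (by positivity) h4
  exact pos_of_mul_pos_left h7 hδ.le

end LTI

theorem mainTheorem3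
    (C Cz a₁ aₖ aₛ θ ε₁ ζ₁ ε₂ ζ₂ : ℝ) (hθ : 0 < θ) (hε₁ : 0 < ε₁) (hε₂ : 0 < ε₂)
    (haε₂ : aₛ + ε₂ < 1) :
    ∃ c : ℝ, 0 < c ∧
      ∀ (n k : ℕ) (hk : 0 < k) (hkn : k < n)
        (A : Matrix (Fin n) (Fin n) ℝ) (lam : Fin n → ℝ)
        (_ : LTI.SpectralAssumption A lam k)
        (_ : |lam ⟨0, by omega⟩| = a₁) (_ : |lam ⟨k - 1, by omega⟩| = aₖ)
        (_ : |lam ⟨k, hkn⟩| = aₛ)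
        (P₁ : Matrix (Fin n) (Fin k) ℝ) (P₂ : Matrix (Fin n) (Fin (n - k)) ℝ)
        (_ : LTI.IsOrthonormalBasisOf P₁ (LTI.unstableSubspace A lam k))
        (_ : P₂ᵀ * P₂ = 1) (_ : P₁ᵀ * P₂ = 0)
        (_ : LTI.IsGelfandConst A ε₁ ζ₁) (_ : LTI.IsGelfandConst (LTI.block A P₂) ε₂ ζ₂)
        (Pbar : Matrix (Fin k) (Fin k) ℝ)
        (_ : LTI.IsJordanForm (LTI.block A P₁) (fun i => lam (Fin.castLE hkn.le i)) Pbar)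
        (Ω : Type*) [MeasurableSpace Ω] (μ : Measure Ω) [IsProbabilityMeasure μ]
        (η : ℕ → Ω → EuclideanSpace ℝ (Fin n))
        (_ : LTI.NoiseAssumption μ η C) (_ : LTI.PdfAssumption μ A P₁ Pbar η Cz)
        (δ : ℝ) (_ : 0 < δ) (_ : δ ≤ 1) (T : ℕ)
        (_ : c * (1 + k * Real.log k + Real.log ((n : ℝ) - k) + Real.log (1 / δ)
          - Real.log (LTI.gap lam k)) ≤ T),
        ∃ S : Set Ω, MeasurableSet S ∧ ENNReal.ofReal (1 - 4 * θ) ≤ μ S ∧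
          ∀ ω ∈ S, ∀ (U : Matrix (Fin n) (Fin n) ℝ) (σ : ℕ → ℝ) (V : Matrix (Fin T) (Fin T) ℝ),
            LTI.IsSVD (LTI.dataMatrix (LTI.state A fun t => η t ω) T) U σ V →
            ∃ Mhat : Matrix (Fin k) (Fin k) ℝ,
              (∀ M : Matrix (Fin k) (Fin k) ℝ,
                LTI.IsLeastSquares (LTI.state A fun t => η t ω) T
                  (LTI.topColumns hkn.le U) M ↔ M = Mhat) ∧
              (∃ Q₁ : Matrix (Fin n) (Fin k) ℝ,
                LTI.IsOrthonormalBasisOf Q₁ (LTI.unstableSubspace A lam k) ∧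
                ‖Q₁ - LTI.topColumns hkn.le U‖ < δ) ∧
              ∀ Q₁ : Matrix (Fin n) (Fin k) ℝ,
                LTI.IsOrthonormalBasisOf Q₁ (LTI.unstableSubspace A lam k) →
                ‖Q₁ - LTI.topColumns hkn.le U‖ < δ →
                ∀ τ : ℕ, 1 ≤ τ →
                  ‖Mhat ^ τ - LTI.block A Q₁ ^ τ‖
                    ≤ 3 * τ * ‖A‖ * ζ₁ ^ 2 * (a₁ + ε₁) ^ (τ - 1) * δ := by
  -- The constants are those of some system only if they satisfy these inequalities.
  by_cases hconst : (0 < C ∧ 0 < Cz) ∧ (1 < aₖ ∧ aₖ ≤ a₁ ∧ 0 ≤ aₛ) ∧ 1 ≤ ζ₁ ∧ 0 ≤ ζ₂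
  swap
  · refine ⟨1, one_pos, ?_⟩
    intro n k hk hkn A lam hA ha₁ haₖ haₛ P₁ P₂ hP₁ hP₂ hP₁₂ hζ₁ hζ₂ Pbar hJ Ω _ μ _ η hη hpdf
    refine absurd ⟨⟨?_, hpdf.pos hk⟩, ⟨?_, ?_, ?_⟩, ?_, ?_⟩ hconst
    · obtain ⟨ω, hω⟩ := (hη.bounded 0).exists
      exact (norm_nonneg _).trans_lt hω
    · rw [← haₖ]
      exact hA.unstable _ (by simp only; omega)
    · rw [← haₖ, ← ha₁]
      exact hA.strictAnti.antitone (by simp [Fin.le_def])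
    · rw [← haₛ]
      exact abs_nonneg _
    · have : NeZero n := ⟨by omega⟩
      have h1 := hζ₁ 0
      simpa using h1
    · simpa using (norm_nonneg _).trans (hζ₂ 0)
  obtain ⟨⟨hC, hCz⟩, ⟨haₖ1, haₖ₁, haₛ0⟩, hζ₁1, hζ₂0⟩ := hconst
  have hb1 : 1 ≤ a₁ + ε₁ := by linarith
  have hq : 0 < 1 - (aₛ + ε₂) := by linarith
  -- `B₂` bounds the stable coordinates, `α` bounds `‖A‖`, `B₄` is the error in the Vandermonde
  -- approximation of the unstable coordinates, and `B₅ T / L` bounds the error of the estimate. All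
  -- conditions of `estimator_accuracy` on `L` follow from `K T B₆ ≤ L δ`.
  set B₂ := ζ₂ * C / (1 - (aₛ + ε₂)) with hB₂
  have hB₂0 : 0 ≤ B₂ := by positivity
  set α := ζ₁ * (a₁ + ε₁) with hα
  have hα0 : 0 ≤ α := by positivity
  set B₄ := (α * B₂ + C) / (aₖ - 1) with hB₄
  have hB₄0 : 0 ≤ B₄ := div_nonneg (by positivity) (by linarith)
  set B₅ := 4 * α * B₂ + C with hB₅
  have hB₅0 : 0 < B₅ := by positivity
  set B₆ := B₅ * (2 + 1 / ε₁) + 8 * B₂ with hB₆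
  have hB₆0 : 0 < B₆ := by positivity
  obtain ⟨c, hc0, hc⟩ := LTI.exists_sampleSize_const (a := aₖ) (b := a₁ + ε₁)
    (B := Cz * ζ₁ * (B₆ + B₄) / θ) haₖ1 hb1 (by positivity)
  refine ⟨c, hc0, ?_⟩
  intro n k hk hkn A lam hA ha₁ haₖ haₛ P₁ P₂ hP₁ hP₂ hP₁₂ hζ₁ hζ₂ Pbar hJ Ω _ μ _ η hη hpdf δ hδ
    hδ1 T hT
  have hone := LTI.mul_transpose_add_eq_one (by omega) hP₁.1 hP₂ hP₁₂
  have hk0 : (0 : ℝ) < k := by exact_mod_cast hk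
  have hlam_le : ∀ i, |lam i| ≤ a₁ := fun i => by
    rw [← ha₁]
    exact hA.strictAnti.antitone (by simp [Fin.le_def])
  have hlam_ge : ∀ i : Fin k, aₖ ≤ |lam (Fin.castLE hkn.le i)| := fun i => by
    rw [← haₖ]
    refine hA.strictAnti.antitone ?_
    rw [Fin.le_def]
    simp only [Fin.val_castLE]
    omega
  have hζA : ∀ t : ℕ, ‖A ^ t‖ ≤ ζ₁ * (a₁ + ε₁) ^ t :=
    hζ₁.norm_pow_le hε₁ (LTI.specRad_le_of_charpoly hA.charpoly_eq (by linarith)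
      fun i _ => hlam_le i)
  have hζM₂ : ∀ t : ℕ, ‖LTI.block A P₂ ^ t‖ ≤ ζ₂ * (aₛ + ε₂) ^ t := by
    refine hζ₂.norm_pow_le hε₂ (LTI.specRad_le_of_charpoly
      (LTI.charpoly_block_stable (by omega) hA hP₁ hP₂ hP₁₂ hJ) haₛ0 fun i hi => ?_)
    rw [← haₛ]
    refine hA.strictAnti.antitone ?_
    rw [Fin.le_def]
    exact (Finset.mem_filter.1 hi).2
  have hAα : ‖A‖ ≤ α := by simpa using hζA 1
  have hA1 : 1 ≤ ‖A‖ := by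
    have h1 := hJ.abs_le_norm ⟨0, hk⟩
    have h2 := hlam_ge ⟨0, hk⟩
    have h3 := LTI.norm_conj_le hP₁.1 A
    have h4 : ‖LTI.block A P₁‖ ≤ ‖A‖ := h3
    linarith
  have hζM₁ : ∀ t : ℕ, ‖LTI.block A P₁ ^ t‖ ≤ ζ₁ * (a₁ + ε₁) ^ t := fun t => by
    rw [hP₁.block_pow]
    exact (LTI.norm_conj_le hP₁.1 _).trans (hζA t)
  set d := (Matrix.vandermonde fun i : Fin k => (lam (Fin.castLE hkn.le i))⁻¹).det with hd
  have hdet : d ≠ 0 := by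
    rw [hd, Matrix.det_vandermonde_ne_zero_iff]
    intro i j hij
    have h1 := hA.strictAnti.injective (congrArg abs (inv_injective hij))
    exact Fin.castLE_injective _ h1
  have hgap : LTI.gap lam k = |d| ^ 2 := by rw [LTI.gap_eq_det_sq hkn.le, sq_abs]
  have hd0 : 0 < |d| := abs_pos.2 hdet
  have hinv : ∀ i : Fin k, |(lam (Fin.castLE hkn.le i))⁻¹| ≤ aₖ⁻¹ := fun i => by
    rw [abs_inv]
    exact inv_anti₀ (by linarith) (hlam_ge i)
  have hgap_le : |d| ^ 2 ≤ (k : ℝ) ^ k * aₖ⁻¹ ^ (k * (k - 1)) := by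
    rw [sq_abs]
    exact LTI.det_vandermonde_sq_le (by positivity) hinv
  have hdk : |d| ≤ k.factorial := by
    have h1 := Matrix.det_le
      (A := Matrix.vandermonde fun i : Fin k => (lam (Fin.castLE hkn.le i))⁻¹)
      (abv := AbsoluteValue.abs) (x := 1) fun i j => by
        rw [Matrix.vandermonde_apply, map_pow]
        exact pow_le_one₀ (abs_nonneg _)
          ((hinv i).trans (inv_le_one_of_one_le₀ haₖ1.le))
    simpa using h1
  have hnk : 0 ≤ Real.log ((n : ℝ) - k) := by
    refine Real.log_nonneg ?_
    have : (k : ℝ) + 1 ≤ n := by exact_mod_cast hkn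
    linarith
  rw [hgap] at hT
  obtain ⟨hkT, hbig⟩ := hc k T _ δ (|d| ^ 2) hk hnk hδ hδ1 (by positivity) hgap_le hT
  have hT0 : 0 < T := by omega
  set κ := k * k.factorial / |d| with hκ
  set K := k * κ * ζ₁ * (a₁ + ε₁) ^ k with hK
  set L := (aₖ ^ T * (θ / (k * Cz)) / κ - k * B₄) / k with hL
  obtain ⟨hK1, hL0, hKL⟩ := LTI.expansion_factor_ge hk hT0 hb1 hζ₁1 hCz hθ hB₄0 hB₆0 hδ hδ1 hd0 hdk
    hκ hK hL hbig
  obtain ⟨S, hSm, hSμ, hS⟩ := LTI.exists_good_event hk hθ hη hpdf hT0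
  refine ⟨S, hSm, hSμ, fun ω hω U σ V hSVD => ?_⟩
  obtain ⟨hηω, hzω⟩ := hS ω hω
  have hB := LTI.euclNorm_stable_le hP₂ (hP₁.transpose_mul_complement hP₁₂ hone) hηω
    (by positivity) haε₂ hζM₂
  have hDL := LTI.euclNorm_dataMatrix_ge (b := B₄) (r := θ / (k * Cz)) (κ := κ) hkT hP₁.1 hP₂ hone
    hJ haₖ1 hlam_ge hdet hηω hB (by
      rw [hB₄]
      have : 0 < aₖ - 1 := by linarith
      gcongr) (by positivity) hzω hκ (by
      rw [hL] at hL0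
      exact (pos_of_mul_pos_left (by simpa [div_eq_mul_inv] using hL0)
        (inv_nonneg.2 hk0.le)).le)
  have hKpow := LTI.norm_pow_le_of_isJordanForm hJ (fun i => haₖ1.le.trans (hlam_ge i))
    (fun i => hlam_le _) hb1 hζM₁ hdet
  have hT0' : (0 : ℝ) ≤ T := Nat.cast_nonneg T
  have hKT : (T : ℝ) ≤ K * T := le_mul_of_one_le_left hT0' hK1
  have hexp : K * T * B₆ = 2 * (K * (T * B₅)) + K * (T * B₅) / ε₁ + 8 * (K * T * B₂) := by
    rw [hB₆]
    ring
  have h1 : 0 ≤ K * (T * B₅) := by positivity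
  have h2 : 0 ≤ K * (T * B₅) / ε₁ := by positivity
  have h3 : 0 ≤ K * T * B₂ := by positivity
  have h4 : T * B₂ ≤ K * T * B₂ := by gcongr
  have h5 : K * (T * (4 * ‖A‖ * B₂ + C)) ≤ K * (T * B₅) := by
    rw [hB₅]
    gcongr
  have h6 : K * (T * B₅) ≤ L * ε₁ := by
    have h7 : K * (T * B₅) / ε₁ ≤ L := by
      have h8 : L * δ ≤ L := mul_le_of_le_one_right hL0.le hδ1
      linarith
    rwa [div_le_iff₀ hε₁] at h7
  obtain ⟨Mhat, hM, hQ, hpow⟩ := LTI.estimator_accuracy hk hkn hkT hP₁ hP₂ hone hηω hB hL0 hDL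
    (by linarith) (by linarith) hKpow hζ₁1 hζA hA1 hε₁ hδ hδ1 (by linarith) (by linarith)
    (by linarith) hSVD
  exact ⟨Mhat, hM, hQ, fun Q₁ hQ₁ hQ₁δ τ _ => hpow Q₁ hQ₁ hQ₁δ τ⟩
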